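/- **Setting.** Let $(x_i,y_i)_{i\ge1}$ be i.i.d. (if there are no regressors, take $x_i$ constant). There are finitely many candidate models $\mathcal M_0,\dots,\mathcal M_K$. In $\mathcal M_k$, with parameter $\theta_k\in\Theta_k\subseteq\mathbb R^{d_k}$ and latent $\mathbf z\in\mathbb R^n$, one has $p_k(\mathbf y\mid\mathbf z)=\prod_i p_k(y_i\mid z_i)$ (densities with respect to a $\sigma$-finite measure $\nu$), $p_k(\mathbf z\mid\theta_k)=\prod_i p_k(z_i\mid x_i,\theta_k)$ (Lebesgue densities), and a possibly improper prior density $p_k(\theta_k)$, which may depend on $n$ and on $x_1,\dots,x_n$. Write $p_k(y\mid x,\theta_k)=\int p_k(y\mid z)\,p_k(z\mid x,\theta_k)\,dz$ and $p_k(\mathbf y\mid\theta_k)=\prod_i p_k(y_i\mid x_i,\theta_k)$. For each $k$ let $q_k(\mathbf z)\,q_k(\theta_k)$ be a data-dependent mean-field (product) approximation of the joint posterior; with probability tending to one, both factors are probability densities with finite means $\hat{\mathbf z}_k=\mathbb E_{q_k}[\mathbf z]$, $\hat\theta_k=\mathbb E_{q_k}[\theta_k]$, and $q_k(\theta_k)$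 has a finite covariance matrix $V_k$. Put $$\mathrm{VBC}_k=-2\log\frac{p_k(\mathbf y\mid\hat{\mathbf z}_k)\,p_k(\hat{\mathbf z}_k\mid\hat\theta_k)\,p_k(\hat\theta_k)}{q_k(\hat{\mathbf z}_k)\,q_k(\hat\theta_k)} .$$ **True model and true parameters.** The data are generated by $\mathcal M_{k^*}$ at $\theta^*_{k^*}$: given $x$, the density of $y$ is $p_{k^*}(y\mid x,\theta^*_{k^*})$. Every other candidate that also contains this conditional law has more parameters, i.e. $d_k>d_{k^*}$. For every $k$, $\theta_k^*$ maximizes $\theta\mapsto\mathbb E\log p_k(y\mid x,\theta)$ over $\Theta_k$. Assume, for every $k$: (i) (regularity) $\Theta_k$ is compact and $\theta_k^*$ is an interior point. Almost surely, $p_k(y\mid x,\cdot)>0$ on $\Theta_k$ and $\ell=\log p_k(y\mid x,\cdot)$ is $C^3$ on the interior. At $\theta_k^*$, $\ell$ has a finite expectation, the score $\nabla\ell$ has a finite second moment, and the Hessian has a finite expectation; the third derivatives of $\ell$ are dominated near $\theta_k^*$ by an integrable function of $(x,y)$. The Fisher information matrix $-\mathbb E\nabla^2\ell(\theta_k^*)$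 is positive definite. With probability tending to one, the prior density is bounded away from $0$ and $\infty$ on a fixed neighbourhood of $\theta_k^*$. (ii), (iii) $q_k(\theta_k)$ is asymptotically Gaussian, centred at $\theta_k^*$: there are a positive definite matrix $\Omega_k$ and (possibly data-dependent) centres $m_{k,n}=\theta_k^*+O_P(n^{-1/2})$, for instance $m_{k,n}=\theta_k^*$, such that $n^{-d_k/2}q_k(m_{k,n}+h/\sqrt n)$ converges in probability to the density of $N(0,\Omega_k)$ at $h$, uniformly for $h$ in bounded sets. (iv) $q_k(\theta_k)$ contracts around $\theta_k^*$ at rate $1/\sqrt n$: $q_k(\|\theta_k-\theta_k^*\|>R_n/\sqrt n)\to0$ in probability whenever $R_n\to\infty$; and $nV_k\to\Omega_k$ in probability. (v) $\dfrac{p_k(\mathbf y\mid\hat{\mathbf z}_k)\,p_k(\hat{\mathbf z}_k\mid\hat\theta_k)}{q_k(\hat{\mathbf z}_k)}=p_k(\mathbf y\mid\hat\theta_k)$ holds exactly, or at least asymptotically, in the sense that the two sides agree up to a factor that is bounded away from $0$ and $\infty$ in probability (in particular, their quotient may tend to $1$ in probability). Then the VBC rule is asymptotically model selection consistent: with probability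 tending to $1$ as $n\to\infty$, $k^*$ is the unique minimizer of $\mathrm{VBC}_k$, i.e. $$\Pr\{\arg\min_k\mathrm{VBC}_k=k^*\}\longrightarrow1 .$$ -/

import Mathlib

open MeasureTheory ProbabilityTheory Filter Topology

noncomputable section

/-- The Euclidean parameter space `ℝ^d`. -/
abbrev Par (d : ℕ) : Type := EuclideanSpace ℝ (Fin d)

/-! ### Stochastic order notation (for possibly non-measurable statistics, through outer measure) -/

section StochasticOrder

variable {Ω : Type*} [MeasurableSpace Ω]

/-- The statement `A n` holds with probability tending to one: the probability that it fails
tends to zero. -/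
def WithHighProb (P : Measure Ω) (A : ℕ → Ω → Prop) : Prop :=
  Tendsto (fun n => P {ω | ¬ A n ω}) atTop (𝓝 0)

/-- `f n = O_P(1)`. -/
def BoundedInProb (P : Measure Ω) (f : ℕ → Ω → ℝ) : Prop :=
  ∀ ε : ℝ, 0 < ε → ∃ C : ℝ, ∀ᶠ n in atTop, P {ω | C < |f n ω|} ≤ ENNReal.ofReal ε

end StochasticOrder

/-! ### Latent data models -/

/-- A latent data model for observations `y` with observed regressors `x`:
`y ∣ z` has density `obs · z` with respect to `ν`, the latent `z ∈ ℝ` has Lebesgue density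
`lat x θ` given the regressors and the parameter `θ ∈ Θ ⊆ ℝ^d`, and `prior n x` is the (possibly
improper) prior density of `θ` at sample size `n`, which may depend on `n` and on the regressors
`x₁, …, xₙ`, as a `g`-prior with `g = n` does. -/
structure LatentModel (X Y : Type*) [MeasurableSpace X] [MeasurableSpace Y] (ν : Measure Y) where
  /-- number of parameters -/
  d : ℕ
  /-- parameter set -/
  Θ : Set (Par d)
  /-- `obs y z = p(y ∣ z)` -/
  obs : Y → ℝ → ℝ
  /-- `lat x θ z = p(z ∣ x, θ)` -/
  lat : X → Par d → ℝ → ℝ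
  /-- `prior n x θ = p(θ)` -/
  prior : (n : ℕ) → (Fin n → X) → Par d → ℝ
  obs_measurable : Measurable fun w : Y × ℝ => obs w.1 w.2
  obs_nonneg : ∀ y z, 0 ≤ obs y z
  obs_mass : ∀ z, ∫⁻ y, ENNReal.ofReal (obs y z) ∂ν = 1
  lat_measurable : ∀ θ ∈ Θ, Measurable fun w : X × ℝ => lat w.1 θ w.2
  lat_nonneg : ∀ θ ∈ Θ, ∀ x z, 0 ≤ lat x θ z
  lat_mass : ∀ θ ∈ Θ, ∀ x, ∫⁻ z, ENNReal.ofReal (lat x θ z) = 1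

namespace LatentModel

variable {X Y : Type*} [MeasurableSpace X] [MeasurableSpace Y] {ν : Measure Y}

/-- Likelihood of one observation `o = (x, y)`, the latent variable integrated out:
`p(y ∣ x, θ) = ∫ p(y ∣ z) p(z ∣ x, θ) dz`. -/
def lik (M : LatentModel X Y ν) (o : X × Y) (θ : Par M.d) : ℝ :=
  ∫ z, M.obs o.2 z * M.lat o.1 θ z

/-- Log-likelihood of one observation. -/
def logLik (M : LatentModel X Y ν) (o : X × Y) (θ : Par M.d) : ℝ :=
  Real.log (M.lik o θ)

/-- `p(𝐲 ∣ θ) = ∏ᵢ p(yᵢ ∣ xᵢ, θ)`. -/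
def sampleLik (M : LatentModel X Y ν) {n : ℕ} (D : Fin n → X × Y) (θ : Par M.d) : ℝ :=
  ∏ i, M.lik (D i) θ

/-- `p(𝐲 ∣ 𝐳) = ∏ᵢ p(yᵢ ∣ zᵢ)`. -/
def sampleObs (M : LatentModel X Y ν) {n : ℕ} (D : Fin n → X × Y) (z : Fin n → ℝ) : ℝ :=
  ∏ i, M.obs (D i).2 (z i)

/-- `p(𝐳 ∣ θ) = ∏ᵢ p(zᵢ ∣ xᵢ, θ)`. -/
def sampleLat (M : LatentModel X Y ν) {n : ℕ} (D : Fin n → X × Y) (θ : Par M.d)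
    (z : Fin n → ℝ) : ℝ :=
  ∏ i, M.lat (D i).1 θ (z i)

/-- The law of one observation `(x, y)` when `x ∼ μX` and `y ∣ x` has density `p(· ∣ x, θ)`. -/
def law (M : LatentModel X Y ν) (μX : Measure X) (θ : Par M.d) : Measure (X × Y) :=
  (μX.prod ν).withDensity fun o => ENNReal.ofReal (M.lik o θ)

/-- The conditional law of `y` given `x` with density `f` (with respect to `ν`) belongs to the
model. -/
def Contains (M : LatentModel X Y ν) (μX : Measure X) (f : X × Y → ℝ) : Prop :=
  ∃ θ ∈ M.Θ, ∀ᵐ o ∂(μX.prod ν), M.lik o θ = f o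

/-- `θs` is the model-specific true parameter value under the data law `P₀`: it maximizes the
expected log-likelihood over the parameter set (it is the parameter closest to `P₀` in
Kullback-Leibler divergence, hence a parameter that generates the data if the model contains
one). A non-integrable log-likelihood has expectation `-∞` and never competes. -/
def IsTrueValue (M : LatentModel X Y ν) (P₀ : Measure (X × Y)) (θs : Par M.d) : Prop :=
  θs ∈ M.Θ ∧ ∀ θ ∈ M.Θ, Integrable (fun o => M.logLik o θ) P₀ →
    ∫ o, M.logLik o θ ∂P₀ ≤ ∫ o, M.logLik o θs ∂P₀

/-- Standard regularity conditions of the likelihood at `θs` under the data law `P₀`. -/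
structure Regular (M : LatentModel X Y ν) (P₀ : Measure (X × Y)) (θs : Par M.d) : Prop where
  /-- the parameter set is compact -/
  compact : IsCompact M.Θ
  /-- the true value is an interior point -/
  mem_interior : θs ∈ interior M.Θ
  /-- the likelihood is positive, so that the log-likelihood is defined -/
  pos : ∀ᵐ o ∂P₀, ∀ θ ∈ M.Θ, 0 < M.lik o θ
  /-- the log-likelihood is three times continuously differentiable -/
  smooth : ∀ᵐ o ∂P₀, ContDiffOn ℝ 3 (M.logLik o) (interior M.Θ)
  /-- moment condition: the log-likelihood has a finite expectation -/
  moment_zero : Integrable (fun o => M.logLik o θs) P₀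
  /-- moment condition: the score has a finite second moment -/
  moment_one : MemLp (fun o => fderiv ℝ (M.logLik o) θs) 2 P₀
  /-- moment condition: the Hessian has a finite expectation -/
  moment_two : Integrable (fun o => iteratedFDeriv ℝ 2 (M.logLik o) θs) P₀
  /-- moment condition: third derivatives are dominated near `θs` by an integrable function -/
  moment_three : ∃ r > 0, Metric.ball θs r ⊆ interior M.Θ ∧ ∃ G : X × Y → ℝ, Integrable G P₀ ∧
    ∀ᵐ o ∂P₀, ∀ θ ∈ Metric.ball θs r, ‖iteratedFDeriv ℝ 3 (M.logLik o) θ‖ ≤ G o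
  /-- the Fisher information matrix (expected negative Hessian) is positive definite -/
  fisher : ∀ v : Par M.d, v ≠ 0 → 0 < -∫ o, iteratedFDeriv ℝ 2 (M.logLik o) θs ![v, v] ∂P₀

/-- Regularity of the prior: with probability tending to one, the prior density is bounded away
from zero and infinity on a fixed neighbourhood of `θs`. -/
def PriorRegular {Ω : Type*} [MeasurableSpace Ω] (M : LatentModel X Y ν) (P : Measure Ω)
    (ξ : ℕ → Ω → X × Y) (θs : Par M.d) : Prop :=
  ∃ r > 0, ∃ c > 0, ∃ C : ℝ, WithHighProb P fun n ω =>
    ∀ θ ∈ Metric.ball θs r,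
      c ≤ M.prior n (fun i => (ξ i ω).1) θ ∧ M.prior n (fun i => (ξ i ω).1) θ ≤ C

end LatentModel

/-! ### Mean-field variational approximations and the criterion -/

/-- A mean-field variational approximation `q(𝐳) q(θ)` of the joint posterior of the latent data
and the parameters, at every sample size and as a function of the data, given by its two density
factors. -/
structure MeanField {X Y : Type*} [MeasurableSpace X] [MeasurableSpace Y] {ν : Measure Y}
    (M : LatentModel X Y ν) where
  /-- `q(𝐳)` -/
  qz : (n : ℕ) → (Fin n → X × Y) → (Fin n → ℝ) → ℝ
  /-- `q(θ)` -/
  qθ : (n : ℕ) → (Fin n → X × Y) → Par M.d → ℝ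

/-- `q` is a probability density on the Euclidean space `E` with a finite mean. -/
def IsDensityWithMean {E : Type*} [NormedAddCommGroup E] [NormedSpace ℝ E] [MeasureSpace E]
    (q : E → ℝ) : Prop :=
  (∀ v, 0 ≤ q v) ∧ Integrable q ∧ ∫ v, q v = 1 ∧ Integrable fun v => q v • v

/-- The density at `h` of the centred Gaussian distribution on `ℝ^d` with covariance `S`. -/
def gaussDensity {d : ℕ} (S : Matrix (Fin d) (Fin d) ℝ) (h : Par d) : ℝ :=
  (Real.sqrt ((2 * Real.pi) ^ d * S.det))⁻¹ *
    Real.exp (-(1 / 2) * (h.ofLp ⬝ᵥ (S⁻¹.mulVec h.ofLp)))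

/-- The first `n` observations. -/
def sample {Ω O : Type*} (ξ : ℕ → Ω → O) (n : ℕ) (ω : Ω) : Fin n → O := fun i => ξ i ω

namespace MeanField

variable {X Y : Type*} [MeasurableSpace X] [MeasurableSpace Y] {ν : Measure Y}
  {M : LatentModel X Y ν} {Ω : Type*} [MeasurableSpace Ω]

/-- The variational mean `ẑ = E_q[𝐳]`. -/
def zHat (Q : MeanField M) {n : ℕ} (D : Fin n → X × Y) : Fin n → ℝ :=
  ∫ z, Q.qz n D z • z

/-- The variational mean `θ̂ = E_q[θ]`. -/
def θHat (Q : MeanField M) {n : ℕ} (D : Fin n → X × Y) : Par M.d :=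
  ∫ θ, Q.qθ n D θ • θ

/-- The variational covariance matrix `V = E_q[(θ - θ̂)(θ - θ̂)ᵀ]`. -/
def cov (Q : MeanField M) {n : ℕ} (D : Fin n → X × Y) : Matrix (Fin M.d) (Fin M.d) ℝ :=
  fun i j => ∫ θ, Q.qθ n D θ * ((θ i - Q.θHat D i) * (θ j - Q.θHat D j))

/-- `p_VBC(𝐲) = p(𝐲 ∣ ẑ) p(ẑ ∣ θ̂) p(θ̂) / (q(ẑ) q(θ̂))`. -/
def pVBC (Q : MeanField M) {n : ℕ} (D : Fin n → X × Y) : ℝ :=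
  M.sampleObs D (Q.zHat D) * M.sampleLat D (Q.θHat D) (Q.zHat D) *
      M.prior n (fun i => (D i).1) (Q.θHat D) /
    (Q.qz n D (Q.zHat D) * Q.qθ n D (Q.θHat D))

/-- The variational Bayes criterion `VBC = -2 log p_VBC(𝐲)`. -/
def VBC (Q : MeanField M) {n : ℕ} (D : Fin n → X × Y) : ℝ :=
  -2 * Real.log (Q.pVBC D)

/-- With probability tending to one, the two factors are probability densities with finite means
and the parameter factor has a finite second moment, so that `ẑ`, `θ̂` and `V` are defined. -/
def WellDefined (Q : MeanField M) (P : Measure Ω) (ξ : ℕ → Ω → X × Y) : Prop :=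
  WithHighProb P fun n ω =>
    IsDensityWithMean (Q.qz n (sample ξ n ω)) ∧
    IsDensityWithMean (Q.qθ n (sample ξ n ω)) ∧
    Integrable fun θ => Q.qθ n (sample ξ n ω) θ * ‖θ‖ ^ 2

/-- `q(θ)` approaches a Gaussian density centred at `θs` with covariance `S / n`: on the scale
`θ = m + h / √n` its density converges in probability, uniformly for `h` in bounded sets, to the
density of `N(0, S)`. The centre `m` is `θs` up to `O_P(1/√n)` (`m = θs` is allowed, as are the
random centres of Bernstein-von Mises theorems). -/
def AsympGaussian (Q : MeanField M) (P : Measure Ω) (ξ : ℕ → Ω → X × Y) (θs : Par M.d)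
    (S : Matrix (Fin M.d) (Fin M.d) ℝ) : Prop :=
  ∃ m : (n : ℕ) → (Fin n → X × Y) → Par M.d,
    BoundedInProb P (fun n ω => Real.sqrt n * ‖m n (sample ξ n ω) - θs‖) ∧
    ∀ R > 0, ∀ ε > 0, WithHighProb P fun n ω => ∀ h : Par M.d, ‖h‖ ≤ R →
      |(Real.sqrt n ^ M.d)⁻¹ *
          Q.qθ n (sample ξ n ω) (m n (sample ξ n ω) + (Real.sqrt n)⁻¹ • h) -
        gaussDensity S h| < ε

/-- `q(θ)` contracts around `θs` at the rate `1/√n`: balls around `θs` with radius of larger order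
than `1/√n` asymptotically receive all of its mass. -/
def Contracts (Q : MeanField M) (P : Measure Ω) (ξ : ℕ → Ω → X × Y) (θs : Par M.d) : Prop :=
  ∀ R : ℕ → ℝ, Tendsto R atTop atTop →
    TendstoInMeasure P
      (fun n ω => ∫ θ in {θ : Par M.d | R n < Real.sqrt n * ‖θ - θs‖}, Q.qθ n (sample ξ n ω) θ)
      atTop fun _ => 0

/-- The variational covariance scales as `1/n`: `n V → S` in probability. -/
def CovScales (Q : MeanField M) (P : Measure Ω) (ξ : ℕ → Ω → X × Y)
    (S : Matrix (Fin M.d) (Fin M.d) ℝ) : Prop :=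
  ∀ i j, TendstoInMeasure P (fun (n : ℕ) ω => (n : ℝ) * Q.cov (n := n) (sample ξ n ω) i j) atTop fun _ => S i j

/-- `p(𝐲 ∣ ẑ) p(ẑ ∣ θ̂) / q(ẑ)`. -/
def latentRatio (Q : MeanField M) {n : ℕ} (D : Fin n → X × Y) : ℝ :=
  M.sampleObs D (Q.zHat D) * M.sampleLat D (Q.θHat D) (Q.zHat D) / Q.qz n D (Q.zHat D)

/-- The identity `p(𝐲 ∣ ẑ) p(ẑ ∣ θ̂) / q(ẑ) = p(𝐲 ∣ θ̂)` holds asymptotically: the two sides agree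
up to a factor that is bounded away from zero and infinity in probability. This covers exact
equality and a quotient that tends to one. -/
def RatioCondition (Q : MeanField M) (P : Measure Ω) (ξ : ℕ → Ω → X × Y) : Prop :=
  ∀ ε : ℝ, 0 < ε → ∃ C : ℝ, 0 < C ∧ ∀ᶠ n in atTop,
    P {ω | ¬ (C⁻¹ * M.sampleLik (sample ξ n ω) (Q.θHat (sample ξ n ω)) ≤
          Q.latentRatio (sample ξ n ω) ∧
        Q.latentRatio (sample ξ n ω) ≤
          C * M.sampleLik (sample ξ n ω) (Q.θHat (sample ξ n ω)))} ≤ ENNReal.ofReal ε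

end MeanField

/-- The set of minimizers of a criterion over a collection of models. -/
def argminSet {ι : Type*} (f : ι → ℝ) : Set ι := {k | ∀ j, f k ≤ f j}

end

/-!
For every candidate model the criterion has the expansion

  `log p_VBC(𝐲) = log p(𝐲 ∣ θs) - (d / 2) log n + O_P(1)`,

the one known from the Bayesian information criterion (`MeanField.log_pVBC_expansion`). It combines
three facts.

* The variational mean `θ̂` is root-`n` consistent (`MeanField.boundedInProb_θHat`): `q(θ)` keeps its
  mass near `θs`, so a mean further away than `1/√n` in order would make the variational covariance
  larger than `1/n` in order.
* At a root-`n` consistent estimator the log-likelihood differs from its value at `θs` by `O_P(1)`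
  (`LatentModel.Regular.boundedInProb_logLik_sub`). The score has mean zero because `θs` is an
  interior maximum of the expected log-likelihood, so the score sum is `O_P(√n)`, and the remainder
  of the first-order Taylor expansion is `O_P(n) ‖θ̂ - θs‖²`. An upper and lower bound is all that
  is needed, so no limit law for `θ̂` enters.
* By the Gaussian approximation `q(θ̂)` has the exact order `n^{d/2}` (`MeanField.log_qθ_θHat`).

It remains to compare `log p(𝐲 ∣ θs)` between the models. By the equality case of the Gibbs
inequality (`LatentModel.logLik_ae_eq_or_integral_lt`), a rival model either contains the data law,
and then the two log-likelihoods agree almost surely and the penalty `(d / 2) log n` decides; or it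
has a strictly smaller expected log-likelihood, and then the law of large numbers gives a gap of
order `n`, which dominates `log n`.
-/

/-! ### Calculus of stochastic orders -/

section StochasticCalculus

variable {Ω : Type*} [MeasurableSpace Ω] {P : Measure Ω}

theorem withHighProb_iff {A : ℕ → Ω → Prop} :
    WithHighProb P A ↔
      ∀ ε : ℝ, 0 < ε → ∀ᶠ n in atTop, P {ω | ¬ A n ω} ≤ ENNReal.ofReal ε := by
  unfold WithHighProb
  rw [ENNReal.tendsto_nhds_zero]
  constructor
  · intro h ε hε
    exact h _ (ENNReal.ofReal_pos.2 hε)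
  · intro h ε hε
    by_cases htop : ε = ⊤
    · simp [htop]
    · have := h ε.toReal (ENNReal.toReal_pos hε.ne' htop)
      rwa [ENNReal.ofReal_toReal htop] at this

theorem WithHighProb.mono {A B : ℕ → Ω → Prop} (hA : WithHighProb P A)
    (h : ∀ᶠ n in atTop, ∀ ω, A n ω → B n ω) : WithHighProb P B := by
  rw [withHighProb_iff] at *
  intro ε hε
  filter_upwards [hA ε hε, h] with n hn hAB
  exact (measure_mono fun ω (hω : ¬ B n ω) (hA : A n ω) => hω (hAB ω hA)).trans hn

theorem WithHighProb.and {A B : ℕ → Ω → Prop} (hA : WithHighProb P A) (hB : WithHighProb P B) :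
    WithHighProb P fun n ω => A n ω ∧ B n ω := by
  rw [withHighProb_iff] at *
  intro ε hε
  filter_upwards [hA (ε / 2) (half_pos hε), hB (ε / 2) (half_pos hε)] with n h1 h2
  calc P {ω | ¬ (A n ω ∧ B n ω)} ≤ P ({ω | ¬ A n ω} ∪ {ω | ¬ B n ω}) := by
        refine measure_mono fun ω hω => ?_
        simp only [Set.mem_union, Set.mem_ofPred_eq] at *
        tauto
    _ ≤ P {ω | ¬ A n ω} + P {ω | ¬ B n ω} := measure_union_le _ _
    _ ≤ ENNReal.ofReal (ε / 2) + ENNReal.ofReal (ε / 2) := add_le_add h1 h2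
    _ = ENNReal.ofReal ε := by
        rw [← ENNReal.ofReal_add (half_pos hε).le (half_pos hε).le, add_halves]

theorem WithHighProb.of_ae {A : ℕ → Ω → Prop} (h : ∀ᵐ ω ∂P, ∀ n, A n ω) : WithHighProb P A := by
  rw [withHighProb_iff]
  intro ε _
  refine Eventually.of_forall fun n => ?_
  have h0 : P {ω | ¬ A n ω} = 0 := by
    refine measure_mono_null (fun ω (hω : ¬ A n ω) => ?_) (ae_iff.1 h)
    exact fun hall : ∀ n, A n ω => hω (hall n)
  rw [h0]
  exact zero_le

theorem WithHighProb.forall_finite {ι : Type*} [Finite ι] {A : ι → ℕ → Ω → Prop}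
    (h : ∀ k, WithHighProb P (A k)) : WithHighProb P fun n ω => ∀ k, A k n ω := by
  cases nonempty_fintype ι
  unfold WithHighProb at *
  have hs : Tendsto (fun n => ∑ k, P {ω | ¬ A k n ω}) atTop (𝓝 0) := by
    simpa using tendsto_finsetSum Finset.univ fun k _ => h k
  refine tendsto_of_tendsto_of_tendsto_of_le_of_le tendsto_const_nhds hs
    (fun _ => zero_le) fun n => ?_
  calc P {ω | ¬ ∀ k, A k n ω} ≤ P (⋃ k, {ω | ¬ A k n ω}) := by
        refine measure_mono fun ω hω => ?_
        simpa using hω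
    _ ≤ ∑ k, P {ω | ¬ A k n ω} := measure_iUnion_fintype_le _ _

/-- A property that holds with high probability on each event where an `O_P(1)` sequence is bounded
by a constant holds with high probability. -/
theorem BoundedInProb.withHighProb_of_local {g : ℕ → Ω → ℝ} (hg : BoundedInProb P g)
    {A : ℕ → Ω → Prop} (h : ∀ R : ℝ, 0 < R → WithHighProb P fun n ω => |g n ω| ≤ R → A n ω) :
    WithHighProb P A := by
  rw [withHighProb_iff]
  intro ε hε
  obtain ⟨C, hC⟩ := hg (ε / 2) (half_pos hε)
  have hR := withHighProb_iff.1 (h (max C 1) (by positivity)) (ε / 2) (half_pos hε)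
  filter_upwards [hC, hR] with n h1 h2
  calc P {ω | ¬ A n ω}
      ≤ P ({ω | C < |g n ω|} ∪ {ω | ¬ (|g n ω| ≤ max C 1 → A n ω)}) := by
        refine measure_mono fun ω hω => ?_
        by_cases hCg : C < |g n ω|
        · exact Or.inl hCg
        · exact Or.inr fun hA => hω (hA ((not_lt.1 hCg).trans (le_max_left _ _)))
    _ ≤ _ := measure_union_le _ _
    _ ≤ ENNReal.ofReal (ε / 2) + ENNReal.ofReal (ε / 2) := add_le_add h1 h2
    _ = ENNReal.ofReal ε := by
        rw [← ENNReal.ofReal_add (half_pos hε).le (half_pos hε).le, add_halves]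

/-- A sequence that is bounded with high probability on each event where an `O_P(1)` sequence is
bounded by a constant is itself `O_P(1)`. -/
theorem BoundedInProb.of_local {f g : ℕ → Ω → ℝ} (hg : BoundedInProb P g)
    (h : ∀ R : ℝ, 0 < R → ∃ C : ℝ, WithHighProb P fun n ω => |g n ω| ≤ R → |f n ω| ≤ C) :
    BoundedInProb P f := by
  intro ε hε
  obtain ⟨C, hC⟩ := hg (ε / 2) (half_pos hε)
  obtain ⟨C', hR⟩ := h (max C 1) (by positivity)
  refine ⟨C', ?_⟩
  filter_upwards [hC, withHighProb_iff.1 hR (ε / 2) (half_pos hε)] with n h1 h2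
  calc P {ω | C' < |f n ω|}
      ≤ P ({ω | C < |g n ω|} ∪ {ω | ¬ (|g n ω| ≤ max C 1 → |f n ω| ≤ C')}) := by
        refine measure_mono fun ω hω => ?_
        by_cases hCg : C < |g n ω|
        · exact Or.inl hCg
        · exact Or.inr fun hA =>
            (not_le.2 hω) (hA ((not_lt.1 hCg).trans (le_max_left _ _)))
    _ ≤ _ := measure_union_le _ _
    _ ≤ ENNReal.ofReal (ε / 2) + ENNReal.ofReal (ε / 2) := add_le_add h1 h2
    _ = ENNReal.ofReal ε := by
        rw [← ENNReal.ofReal_add (half_pos hε).le (half_pos hε).le, add_halves]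

theorem BoundedInProb.of_withHighProb {f : ℕ → Ω → ℝ} (C : ℝ)
    (h : WithHighProb P fun n ω => |f n ω| ≤ C) : BoundedInProb P f := by
  intro ε hε
  refine ⟨C, ?_⟩
  filter_upwards [withHighProb_iff.1 h ε hε] with n hn
  simpa only [not_le] using hn

theorem BoundedInProb.of_le {f g : ℕ → Ω → ℝ} (hg : BoundedInProb P g)
    (h : WithHighProb P fun n ω => |f n ω| ≤ |g n ω|) : BoundedInProb P f :=
  hg.of_local fun R _ => ⟨R, h.mono (Eventually.of_forall fun _ _ h1 h2 => h1.trans h2)⟩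

theorem BoundedInProb.abs_add_abs {f g : ℕ → Ω → ℝ} (hf : BoundedInProb P f)
    (hg : BoundedInProb P g) : BoundedInProb P fun n ω => |f n ω| + |g n ω| := by
  intro ε hε
  obtain ⟨C, hC⟩ := hf (ε / 2) (half_pos hε)
  obtain ⟨C', hC'⟩ := hg (ε / 2) (half_pos hε)
  refine ⟨C + C', ?_⟩
  filter_upwards [hC, hC'] with n h1 h2
  calc P {ω | C + C' < |(|f n ω| + |g n ω|)|}
      ≤ P ({ω | C < |f n ω|} ∪ {ω | C' < |g n ω|}) := by
        refine measure_mono fun ω hω => ?_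
        by_contra hcon
        simp only [Set.mem_union, Set.mem_ofPred_eq, not_or, not_lt] at hcon hω
        rw [abs_of_nonneg (by positivity)] at hω
        linarith [hcon.1, hcon.2]
    _ ≤ _ := measure_union_le _ _
    _ ≤ ENNReal.ofReal (ε / 2) + ENNReal.ofReal (ε / 2) := add_le_add h1 h2
    _ = ENNReal.ofReal ε := by
        rw [← ENNReal.ofReal_add (half_pos hε).le (half_pos hε).le, add_halves]

theorem BoundedInProb.add {f g : ℕ → Ω → ℝ} (hf : BoundedInProb P f) (hg : BoundedInProb P g) :
    BoundedInProb P fun n ω => f n ω + g n ω :=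
  (hf.abs_add_abs hg).of_le <| .of_ae <| ae_of_all _ fun _ _ =>
    (_root_.abs_add_le _ _).trans (le_abs_self _)

theorem BoundedInProb.sub {f g : ℕ → Ω → ℝ} (hf : BoundedInProb P f) (hg : BoundedInProb P g) :
    BoundedInProb P fun n ω => f n ω - g n ω :=
  (hf.abs_add_abs hg).of_le <| .of_ae <| ae_of_all _ fun _ _ =>
    (abs_sub _ _).trans (le_abs_self _)

theorem BoundedInProb.mul {f g : ℕ → Ω → ℝ} (hf : BoundedInProb P f) (hg : BoundedInProb P g) :
    BoundedInProb P fun n ω => f n ω * g n ω := by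
  refine (hf.abs_add_abs hg).of_local fun R _ => ⟨R * R, .of_ae <| ae_of_all _ fun ω n h => ?_⟩
  have h' := (le_abs_self _).trans h
  have h1 : |f n ω| ≤ R := by linarith [abs_nonneg (g n ω)]
  have h2 : |g n ω| ≤ R := by linarith [abs_nonneg (f n ω)]
  rw [abs_mul]
  gcongr

theorem BoundedInProb.finsetSum {ι : Type*} (s : Finset ι) {f : ι → ℕ → Ω → ℝ}
    (h : ∀ i ∈ s, BoundedInProb P (f i)) : BoundedInProb P fun n ω => ∑ i ∈ s, f i n ω := by
  classical
  induction s using Finset.induction_on with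
  | empty => exact .of_withHighProb 0 (.of_ae <| ae_of_all _ fun ω n => by simp)
  | insert a s ha ih =>
    simp only [Finset.sum_insert ha]
    exact (h a (Finset.mem_insert_self a s)).add
      (ih fun i hi => h i (Finset.mem_insert_of_mem hi))

/-- An `O_P(1)` sequence is eventually dominated by any deterministic sequence tending to
infinity. -/
theorem BoundedInProb.lt_of_tendsto_atTop {f : ℕ → Ω → ℝ} (hf : BoundedInProb P f) {a : ℕ → ℝ}
    (ha : Tendsto a atTop atTop) : WithHighProb P fun n ω => |f n ω| < a n := by
  refine hf.withHighProb_of_local fun R _ => ?_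
  rw [withHighProb_iff]
  intro ε _
  filter_upwards [ha.eventually_gt_atTop R] with n hn
  have : {ω | ¬ (|f n ω| ≤ R → |f n ω| < a n)} = ∅ := by
    ext ω
    simp only [Set.mem_ofPred_eq, Set.mem_empty_iff_false, iff_false, not_not]
    exact fun h => h.trans_lt hn
  rw [this]
  simp

/-- A sequence that is dominated with high probability by every deterministic sequence tending to
infinity is `O_P(1)`. -/
theorem BoundedInProb.of_forall_tendsto_atTop {f : ℕ → Ω → ℝ}
    (h : ∀ a : ℕ → ℝ, Tendsto a atTop atTop → WithHighProb P fun n ω => |f n ω| ≤ a n) :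
    BoundedInProb P f := by
  by_contra hcon
  unfold BoundedInProb at hcon
  push Not at hcon
  obtain ⟨ε, hε, hC⟩ := hcon
  -- sample sizes `N 0 < N 1 < …` at which `|f| > k` still has probability above `ε`
  obtain ⟨N, hN, hNP⟩ := extraction_forall_of_frequently
    (fun k : ℕ => hC (k : ℝ))
  -- a sequence tending to infinity that takes the value `k` at `N k`
  have hidx : Tendsto (fun n => Nat.findGreatest (fun k => N k ≤ n) n) atTop atTop := by
    refine tendsto_atTop.2 fun b => ?_
    filter_upwards [eventually_ge_atTop (N b)] with n hn
    exact Nat.le_findGreatest (hN.id_le b |>.trans hn) hn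
  have hval : ∀ k, Nat.findGreatest (fun j => N j ≤ N k) (N k) = k := by
    intro k
    apply le_antisymm
    · have := Nat.findGreatest_spec (P := fun j => N j ≤ N k) (hN.id_le k) le_rfl
      exact hN.le_iff_le.1 this
    · exact Nat.le_findGreatest (hN.id_le k) le_rfl
  have hw := withHighProb_iff.1 (h _ (tendsto_natCast_atTop_atTop.comp hidx)) ε hε
  obtain ⟨k, hk⟩ := (hN.tendsto_atTop.eventually hw).exists
  have hk2 := hNP k
  simp only [Function.comp, hval, not_le] at hk
  exact absurd hk (not_le.2 hk2)

theorem WithHighProb.of_tendstoInMeasure {f : ℕ → Ω → ℝ} {c : ℝ}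
    (h : TendstoInMeasure P f atTop fun _ => c) {δ : ℝ} (hδ : 0 < δ) :
    WithHighProb P fun n ω => |f n ω - c| < δ := by
  have := h (ENNReal.ofReal δ) (ENNReal.ofReal_pos.2 hδ)
  unfold WithHighProb
  convert this using 5 with n ω
  rw [edist_dist, Real.dist_eq, ENNReal.ofReal_le_ofReal_iff (abs_nonneg _), not_lt]

theorem BoundedInProb.of_tendstoInMeasure {f : ℕ → Ω → ℝ} {c : ℝ}
    (h : TendstoInMeasure P f atTop fun _ => c) : BoundedInProb P f := by
  refine .of_withHighProb (1 + |c|) ((WithHighProb.of_tendstoInMeasure h one_pos).mono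
    (Eventually.of_forall fun n ω hω => ?_))
  have : |f n ω| ≤ |f n ω - c| + |c| := by
    simpa using _root_.abs_add_le (f n ω - c) c
  linarith

/-- Chebyshev-type criterion: second moments bounded by a constant give `O_P(1)`. -/
theorem BoundedInProb.of_variance_le [IsFiniteMeasure P] {f : ℕ → Ω → ℝ} {σ : ℝ}
    (hL : ∀ n, MemLp (f n) 2 P) (hmean : ∀ n, ∫ ω, f n ω ∂P = 0)
    (hvar : ∀ n, Var[f n; P] ≤ σ) : BoundedInProb P f := by
  intro ε hε
  have hσ : 0 ≤ σ := (variance_nonneg (f 0) P).trans (hvar 0)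
  set C := Real.sqrt ((σ + 1) / ε) with hCdef
  have hC : 0 < C := Real.sqrt_pos.2 (by positivity)
  have hC2 : C ^ 2 = (σ + 1) / ε := Real.sq_sqrt (by positivity)
  refine ⟨C, Eventually.of_forall fun n => ?_⟩
  have h1 := meas_ge_le_variance_div_sq (hL n) hC
  simp only [hmean n, sub_zero] at h1
  refine (measure_mono fun ω (hω : C < |f n ω|) => hω.le).trans (h1.trans ?_)
  apply ENNReal.ofReal_le_ofReal
  rw [hC2, div_div_eq_mul_div, div_le_iff₀ (by positivity)]
  nlinarith [hvar n]

end StochasticCalculus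

/-! ### Marginal likelihoods and the information inequality -/

namespace LatentModel

variable {X Y : Type*} [MeasurableSpace X] [MeasurableSpace Y] {ν : Measure Y}

theorem measurable_obs_mul_lat (M : LatentModel X Y ν) {θ : Par M.d} (hθ : θ ∈ M.Θ) :
    Measurable fun w : (X × Y) × ℝ => M.obs w.1.2 w.2 * M.lat w.1.1 θ w.2 := by
  have h1 := M.obs_measurable.comp
    (Measurable.prodMk (measurable_snd.comp measurable_fst) measurable_snd :
      Measurable fun w : (X × Y) × ℝ => (w.1.2, w.2))
  have h2 := (M.lat_measurable θ hθ).comp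
    (Measurable.prodMk (measurable_fst.comp measurable_fst) measurable_snd :
      Measurable fun w : (X × Y) × ℝ => (w.1.1, w.2))
  exact h1.mul h2

theorem measurable_lik (M : LatentModel X Y ν) {θ : Par M.d} (hθ : θ ∈ M.Θ) :
    Measurable fun o : X × Y => M.lik o θ :=
  ((M.measurable_obs_mul_lat hθ).stronglyMeasurable.integral_prod_right').measurable

theorem measurable_logLik (M : LatentModel X Y ν) {θ : Par M.d} (hθ : θ ∈ M.Θ) :
    Measurable fun o : X × Y => M.logLik o θ :=
  Real.measurable_log.comp (M.measurable_lik hθ)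

theorem lik_nonneg (M : LatentModel X Y ν) {θ : Par M.d} (hθ : θ ∈ M.Θ) (o : X × Y) :
    0 ≤ M.lik o θ :=
  integral_nonneg fun _ => mul_nonneg (M.obs_nonneg _ _) (M.lat_nonneg θ hθ _ _)

theorem lintegral_lik (M : LatentModel X Y ν) [SigmaFinite ν] (μX : Measure X)
    [IsProbabilityMeasure μX] {θ : Par M.d} (hθ : θ ∈ M.Θ) :
    ∫⁻ o, ENNReal.ofReal (M.lik o θ) ∂(μX.prod ν) = 1 := by
  set F : X × Y → ENNReal := fun o => ∫⁻ z, ENNReal.ofReal (M.obs o.2 z * M.lat o.1 θ z) with hF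
  have hobs : Measurable fun w : Y × ℝ => ENNReal.ofReal (M.obs w.1 w.2) :=
    M.obs_measurable.ennreal_ofReal
  have hlat : Measurable fun w : X × ℝ => ENNReal.ofReal (M.lat w.1 θ w.2) :=
    (M.lat_measurable θ hθ).ennreal_ofReal
  have hFeq : ∀ x y, F (x, y) =
      ∫⁻ z, ENNReal.ofReal (M.obs y z) * ENNReal.ofReal (M.lat x θ z) := fun x y =>
    lintegral_congr fun _ => ENNReal.ofReal_mul (M.obs_nonneg _ _)
  have hFm : Measurable F := (M.measurable_obs_mul_lat hθ).ennreal_ofReal.lintegral_prod_right'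
  have hFint : ∫⁻ o, F o ∂(μX.prod ν) = 1 := by
    rw [lintegral_prod _ hFm.aemeasurable]
    have hx : ∀ x, ∫⁻ y, F (x, y) ∂ν = 1 := by
      intro x
      simp only [hFeq]
      have hswap : Measurable fun w : Y × ℝ =>
          ENNReal.ofReal (M.obs w.1 w.2) * ENNReal.ofReal (M.lat x θ w.2) :=
        hobs.mul (hlat.comp (Measurable.prodMk measurable_const measurable_snd :
          Measurable fun w : Y × ℝ => (x, w.2)))
      rw [lintegral_lintegral_swap hswap.aemeasurable]
      have hz : ∀ z, ∫⁻ y, ENNReal.ofReal (M.obs y z) * ENNReal.ofReal (M.lat x θ z) ∂ν =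
          ENNReal.ofReal (M.lat x θ z) := by
        intro z
        have hy : Measurable fun y => ENNReal.ofReal (M.obs y z) :=
          hobs.comp (Measurable.prodMk measurable_id measurable_const :
            Measurable fun y : Y => (y, z))
        rw [lintegral_mul_const _ hy, M.obs_mass z, one_mul]
      simp only [hz, M.lat_mass θ hθ x]
    simp [hx]
  have hfin : ∀ᵐ o ∂(μX.prod ν), F o < ⊤ :=
    ae_lt_top hFm (by rw [hFint]; exact ENNReal.one_ne_top)
  rw [← hFint]
  refine lintegral_congr_ae ?_
  filter_upwards [hfin] with o ho
  have hsec : Measurable fun z => M.obs o.2 z * M.lat o.1 θ z :=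
    (M.measurable_obs_mul_lat hθ).comp (Measurable.prodMk measurable_const measurable_id :
      Measurable fun z : ℝ => (o, z))
  rw [lik, integral_eq_lintegral_of_nonneg_ae
    (ae_of_all _ fun _ => mul_nonneg (M.obs_nonneg _ _) (M.lat_nonneg θ hθ _ _))
    hsec.aestronglyMeasurable]
  exact ENNReal.ofReal_toReal ho.ne

theorem isProbabilityMeasure_law (M : LatentModel X Y ν) [SigmaFinite ν] (μX : Measure X)
    [IsProbabilityMeasure μX] {θ : Par M.d} (hθ : θ ∈ M.Θ) :
    IsProbabilityMeasure (M.law μX θ) :=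
  ⟨by rw [law, withDensity_apply _ MeasurableSet.univ, Measure.restrict_univ,
    M.lintegral_lik μX hθ]⟩

theorem logLik_ae_eq_of_lik_ae_eq {M M' : LatentModel X Y ν} {μX : Measure X}
    {θ : Par M.d} {θ' : Par M'.d} (hθ : θ ∈ M.Θ)
    (h : ∀ᵐ o ∂(μX.prod ν), M'.lik o θ' = M.lik o θ) :
    (fun o => M'.logLik o θ') =ᵐ[M.law μX θ] fun o => M.logLik o θ := by
  have : ∀ᵐ o ∂(M.law μX θ), M'.lik o θ' = M.lik o θ := by
    rw [law, ae_withDensity_iff (M.measurable_lik hθ).ennreal_ofReal]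
    filter_upwards [h] with o ho _ using ho
  filter_upwards [this] with o ho
  simp only [logLik, ho]

/-- The equality case of the Gibbs inequality `E log p' ≤ E log p`: a likelihood whose expected
logarithm under `p` is at least that of `p` itself coincides with `p`. -/
theorem lik_ae_eq_of_integral_logLik_le {M M' : LatentModel X Y ν} [SigmaFinite ν]
    {μX : Measure X} [IsProbabilityMeasure μX] {θ : Par M.d} {θ' : Par M'.d}
    (hθ : θ ∈ M.Θ) (hθ' : θ' ∈ M'.Θ)
    (hpos : ∀ᵐ o ∂(M.law μX θ), 0 < M.lik o θ) (hpos' : ∀ᵐ o ∂(M.law μX θ), 0 < M'.lik o θ')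
    (hint : Integrable (fun o => M.logLik o θ) (M.law μX θ))
    (hint' : Integrable (fun o => M'.logLik o θ') (M.law μX θ))
    (hle : ∫ o, M.logLik o θ ∂(M.law μX θ) ≤ ∫ o, M'.logLik o θ' ∂(M.law μX θ)) :
    ∀ᵐ o ∂(μX.prod ν), M'.lik o θ' = M.lik o θ := by
  have := M.isProbabilityMeasure_law μX hθ
  set P₀ := M.law μX θ with hP₀
  have hm := M.measurable_lik hθ
  have hm' := M'.measurable_lik hθ'
  set g : X × Y → ℝ := fun o => M'.lik o θ' / M.lik o θ with hg
  have hgm : Measurable g := hm'.div hm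
  have hgnn : ∀ o, 0 ≤ g o := fun o => div_nonneg (M'.lik_nonneg hθ' o) (M.lik_nonneg hθ o)
  have hglint : ∫⁻ o, ENNReal.ofReal (g o) ∂P₀ ≤ 1 := by
    rw [hP₀, law, lintegral_withDensity_eq_lintegral_mul _ hm.ennreal_ofReal hgm.ennreal_ofReal,
      ← M'.lintegral_lik μX hθ']
    refine lintegral_mono fun o => ?_
    simp only [Pi.mul_apply]
    rw [← ENNReal.ofReal_mul (M.lik_nonneg hθ o)]
    apply ENNReal.ofReal_le_ofReal
    rcases (M.lik_nonneg hθ o).eq_or_lt with h0 | h0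
    · rw [← h0, zero_mul]; exact M'.lik_nonneg hθ' o
    · rw [hg]; simp only; rw [mul_div_cancel₀ _ h0.ne']
  have hgint : Integrable g P₀ := by
    refine ⟨hgm.aestronglyMeasurable, ?_⟩
    rw [hasFiniteIntegral_iff_ofReal (ae_of_all _ hgnn)]
    exact hglint.trans_lt ENNReal.one_lt_top
  have hgE : ∫ o, g o ∂P₀ ≤ 1 := by
    rw [integral_eq_lintegral_of_nonneg_ae (ae_of_all _ hgnn) hgm.aestronglyMeasurable]
    exact ENNReal.toReal_le_of_le_ofReal zero_le_one (by simpa using hglint)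
  have hlog : ∀ᵐ o ∂P₀, Real.log (g o) = M'.logLik o θ' - M.logLik o θ := by
    filter_upwards [hpos, hpos'] with o h1 h2
    exact Real.log_div h2.ne' h1.ne'
  -- the nonnegative variable `g - 1 - log g` has a nonpositive expectation, hence vanishes
  have hg1int : Integrable (fun o => g o - 1) P₀ := hgint.sub (integrable_const 1)
  have hdint : Integrable (fun o => M'.logLik o θ' - M.logLik o θ) P₀ := hint'.sub hint
  have hkint : Integrable (fun o => g o - 1 - (M'.logLik o θ' - M.logLik o θ)) P₀ :=
    hg1int.sub hdint
  have hknn : 0 ≤ᵐ[P₀] fun o => g o - 1 - (M'.logLik o θ' - M.logLik o θ) := by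
    filter_upwards [hlog, hpos, hpos'] with o h h1 h2
    have := Real.log_le_sub_one_of_pos (div_pos h2 h1 : 0 < g o)
    simp only [Pi.zero_apply]
    linarith
  have hkE : ∫ o, (g o - 1 - (M'.logLik o θ' - M.logLik o θ)) ∂P₀ ≤ 0 := by
    rw [integral_sub hg1int hdint,
      integral_sub hgint (integrable_const 1), integral_sub hint' hint]
    simp only [integral_const, probReal_univ, smul_eq_mul, mul_one]
    linarith
  have hk0 := (integral_eq_zero_iff_of_nonneg_ae hknn hkint).1
    (le_antisymm hkE (integral_nonneg_of_ae hknn))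
  have heq : ∀ᵐ o ∂P₀, M'.lik o θ' = M.lik o θ := by
    filter_upwards [hk0, hlog, hpos, hpos'] with o h0 h h1 h2
    have hg1 : g o = 1 := by
      by_contra hne
      have := Real.log_lt_sub_one_of_pos (div_pos h2 h1 : 0 < g o) hne
      simp only [Pi.zero_apply] at h0
      linarith
    exact (div_eq_one_iff_eq h1.ne').1 hg1
  rw [hP₀, law, ae_withDensity_iff hm.ennreal_ofReal] at heq
  -- equality where `p > 0`, and both densities have total mass one
  have hleae : (fun o => ENNReal.ofReal (M.lik o θ)) ≤ᵐ[μX.prod ν]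
      fun o => ENNReal.ofReal (M'.lik o θ') := by
    filter_upwards [heq] with o ho
    by_cases h0 : ENNReal.ofReal (M.lik o θ) = 0
    · rw [h0]; exact zero_le
    · rw [ho h0]
  have := ae_eq_of_ae_le_of_lintegral_le hleae
    (by rw [M.lintegral_lik μX hθ]; exact ENNReal.one_ne_top) hm'.ennreal_ofReal.aemeasurable
    (by rw [M.lintegral_lik μX hθ, M'.lintegral_lik μX hθ'])
  filter_upwards [this] with o ho
  exact ((ENNReal.ofReal_eq_ofReal_iff (M.lik_nonneg hθ o) (M'.lik_nonneg hθ' o)).1 ho).symm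

/-! ### Expansion of the log-likelihood at the true value -/

/-- Quadratic bound on the first-order Taylor remainder of a `C³` function on a ball, in terms of
its Hessian at the centre and a bound on its third derivative. -/
theorem _root_.abs_sub_sub_fderiv_le {E : Type*} [NormedAddCommGroup E] [NormedSpace ℝ E]
    {f : E → ℝ} {a : E} {r G : ℝ} (hf : ∀ x ∈ Metric.ball a r, ContDiffAt ℝ 3 f x)
    (hG : ∀ x ∈ Metric.ball a r, ‖iteratedFDeriv ℝ 3 f x‖ ≤ G) {x : E}
    (hx : x ∈ Metric.ball a r) :
    |f x - f a - fderiv ℝ f a (x - a)| ≤ (‖iteratedFDeriv ℝ 2 f a‖ + G * r) * ‖x - a‖ ^ 2 := by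
  have hr : 0 < r := Metric.pos_of_mem_ball hx
  have ha : a ∈ Metric.ball a r := Metric.mem_ball_self hr
  have hG0 : 0 ≤ G := (norm_nonneg _).trans (hG a ha)
  have hconv := convex_ball a r
  have hess : ∀ y ∈ Metric.ball a r,
      ‖fderiv ℝ (fderiv ℝ f) y‖ ≤ ‖iteratedFDeriv ℝ 2 f a‖ + G * r := by
    intro y hy
    have h1 := hconv.norm_image_sub_le_of_norm_fderiv_le (𝕜 := ℝ) (f := iteratedFDeriv ℝ 2 f)
      (fun z hz => (hf z hz).differentiableAt_iteratedFDeriv (by norm_num))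
      (fun z hz => by rw [norm_fderiv_iteratedFDeriv]; exact hG z hz) ha hy
    have h2 : ‖y - a‖ ≤ r := by rw [← dist_eq_norm]; exact (Metric.mem_ball.1 hy).le
    have h3 : ‖fderiv ℝ (fderiv ℝ f) y‖ = ‖iteratedFDeriv ℝ 2 f y‖ := by
      rw [← norm_iteratedFDeriv_one, norm_iteratedFDeriv_fderiv]
    have h4 : ‖iteratedFDeriv ℝ 2 f y‖ ≤
        ‖iteratedFDeriv ℝ 2 f a‖ + ‖iteratedFDeriv ℝ 2 f y - iteratedFDeriv ℝ 2 f a‖ :=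
      norm_le_norm_add_norm_sub' _ _
    have h5 : G * ‖y - a‖ ≤ G * r := by gcongr
    linarith
  set H := ‖iteratedFDeriv ℝ 2 f a‖ + G * r with hH
  have hH0 : 0 ≤ H := by positivity
  have hgrad : ∀ y ∈ Metric.ball a r, ‖fderiv ℝ f y - fderiv ℝ f a‖ ≤ H * ‖y - a‖ := by
    intro y hy
    refine hconv.norm_image_sub_le_of_norm_fderiv_le (𝕜 := ℝ) (fun z hz => ?_) hess ha hy
    exact ((hf z hz).fderiv_right (m := 2) (by norm_num)).differentiableAt (by norm_num)
  have hsub : Metric.closedBall a ‖x - a‖ ⊆ Metric.ball a r :=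
    Metric.closedBall_subset_ball (by rw [← dist_eq_norm]; exact Metric.mem_ball.1 hx)
  have := (convex_closedBall a ‖x - a‖).norm_image_sub_le_of_norm_fderiv_le' (𝕜 := ℝ)
    (f := f) (φ := fderiv ℝ f a) (C := H * ‖x - a‖)
    (fun z hz => (hf z (hsub hz)).differentiableAt (by norm_num))
    (fun z hz => (hgrad z (hsub hz)).trans (by
      gcongr
      rw [← dist_eq_norm]; exact Metric.mem_closedBall.1 hz))
    (Metric.mem_closedBall_self (norm_nonneg _))
    (by rw [Metric.mem_closedBall, dist_eq_norm])
  rw [Real.norm_eq_abs] at this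
  rw [pow_two, ← mul_assoc]
  exact this

/-- Under the regularity conditions the log-likelihood of one observation has, on a ball around the
true value, a quadratic Taylor bound with an integrable coefficient. -/
theorem Regular.exists_taylor {M : LatentModel X Y ν} {P₀ : Measure (X × Y)} {θs : Par M.d}
    (h : M.Regular P₀ θs) :
    ∃ r > 0, Metric.ball θs r ⊆ M.Θ ∧ ∃ H : X × Y → ℝ, Integrable H P₀ ∧
      ∀ᵐ o ∂P₀, ∀ θ ∈ Metric.ball θs r,
        |M.logLik o θ - M.logLik o θs - fderiv ℝ (M.logLik o) θs (θ - θs)| ≤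
          H o * ‖θ - θs‖ ^ 2 := by
  obtain ⟨r, hr, hsub, G, hG, hGle⟩ := h.moment_three
  refine ⟨r, hr, hsub.trans interior_subset,
    fun o => ‖iteratedFDeriv ℝ 2 (M.logLik o) θs‖ + G o * r,
    h.moment_two.norm.add (hG.mul_const r), ?_⟩
  filter_upwards [h.smooth, hGle] with o hs hg θ hθ
  exact abs_sub_sub_fderiv_le
    (fun x hx => hs.contDiffAt (isOpen_interior.mem_nhds (hsub hx))) hg hθ

theorem Regular.score_memLp {M : LatentModel X Y ν} {P₀ : Measure (X × Y)} {θs : Par M.d}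
    (h : M.Regular P₀ θs) (v : Par M.d) :
    MemLp (fun o => fderiv ℝ (M.logLik o) θs v) 2 P₀ :=
  (ContinuousLinearMap.apply ℝ ℝ v).comp_memLp' h.moment_one

/-- The score has mean zero: the true value is an interior maximum of the expected log-likelihood,
and the quadratic Taylor bound makes this function differentiable there. -/
theorem Regular.integral_score_eq_zero {M : LatentModel X Y ν} {P₀ : Measure (X × Y)}
    [IsProbabilityMeasure P₀] {θs : Par M.d} (h : M.Regular P₀ θs) (hv : M.IsTrueValue P₀ θs)
    (v : Par M.d) : ∫ o, fderiv ℝ (M.logLik o) θs v ∂P₀ = 0 := by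
  obtain ⟨r, hr, hsub, H, hH, hTaylor⟩ := h.exists_taylor
  have hsint : ∀ v, Integrable (fun o => fderiv ℝ (M.logLik o) θs v) P₀ := fun v =>
    (h.score_memLp v).integrable one_le_two
  -- one-sided bound in every direction
  have key : ∀ v : Par M.d, ∫ o, fderiv ℝ (M.logLik o) θs v ∂P₀ ≤ 0 := by
    intro v
    set s := ∫ o, fderiv ℝ (M.logLik o) θs v ∂P₀ with hs
    have hball : ∀ᶠ t : ℝ in 𝓝[>] 0, θs + t • v ∈ Metric.ball θs r := by
      have hc : Tendsto (fun t : ℝ => θs + t • v) (𝓝[>] 0) (𝓝 θs) := by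
        have : Continuous fun t : ℝ => θs + t • v := by fun_prop
        simpa using (this.tendsto 0).mono_left nhdsWithin_le_nhds
      exact hc.eventually (Metric.ball_mem_nhds θs hr)
    have hev : ∀ᶠ t : ℝ in 𝓝[>] 0, s ≤ t * ((∫ o, H o ∂P₀) * ‖v‖ ^ 2) := by
      filter_upwards [hball, self_mem_nhdsWithin] with t ht ht0
      have ht0 : 0 < t := ht0
      have hrem : ∀ᵐ o ∂P₀, |M.logLik o (θs + t • v) - M.logLik o θs -
          t * fderiv ℝ (M.logLik o) θs v| ≤ H o * (t ^ 2 * ‖v‖ ^ 2) := by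
        filter_upwards [hTaylor] with o ho
        have := ho _ ht
        rw [add_sub_cancel_left, map_smul, smul_eq_mul, norm_smul, mul_pow, Real.norm_eq_abs,
          sq_abs] at this
        exact this
      have hlin : Integrable (fun o => M.logLik o θs + t * fderiv ℝ (M.logLik o) θs v) P₀ :=
        h.moment_zero.add ((hsint v).const_mul t)
      have hHt : Integrable (fun o => H o * (t ^ 2 * ‖v‖ ^ 2)) P₀ := hH.mul_const _
      have hmeas := M.measurable_logLik (hsub ht)
      have hintt : Integrable (fun o => M.logLik o (θs + t • v)) P₀ := by
        refine Integrable.mono' (hlin.norm.add hHt) hmeas.aestronglyMeasurable ?_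
        filter_upwards [hrem] with o ho
        simp only [Pi.add_apply, Real.norm_eq_abs]
        have h1 := _root_.abs_add_le (M.logLik o θs + t * fderiv ℝ (M.logLik o) θs v)
          (M.logLik o (θs + t • v) - M.logLik o θs - t * fderiv ℝ (M.logLik o) θs v)
        have h2 : M.logLik o θs + t * fderiv ℝ (M.logLik o) θs v +
          (M.logLik o (θs + t • v) - M.logLik o θs - t * fderiv ℝ (M.logLik o) θs v) =
            M.logLik o (θs + t • v) := by ring
        rw [h2] at h1
        linarith
      have hmax := hv.2 _ (hsub ht) hintt
      have hlow : ∫ o, (M.logLik o θs + t * fderiv ℝ (M.logLik o) θs v) ∂P₀ -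
          ∫ o, H o * (t ^ 2 * ‖v‖ ^ 2) ∂P₀ ≤ ∫ o, M.logLik o (θs + t • v) ∂P₀ := by
        rw [← integral_sub hlin hHt]
        refine integral_mono_ae (hlin.sub hHt) hintt ?_
        filter_upwards [hrem] with o ho
        have := (abs_le.1 ho).1
        linarith
      rw [integral_add h.moment_zero ((hsint v).const_mul t), integral_const_mul,
        integral_mul_const, ← hs] at hlow
      have : t * s ≤ t * (t * ((∫ o, H o ∂P₀) * ‖v‖ ^ 2)) := by nlinarith
      exact le_of_mul_le_mul_left this ht0
    have hlim : Tendsto (fun t : ℝ => t * ((∫ o, H o ∂P₀) * ‖v‖ ^ 2)) (𝓝[>] 0) (𝓝 0) := by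
      have : Continuous fun t : ℝ => t * ((∫ o, H o ∂P₀) * ‖v‖ ^ 2) := by fun_prop
      simpa using (this.tendsto 0).mono_left nhdsWithin_le_nhds
    exact ge_of_tendsto hlim hev
  refine le_antisymm (key v) ?_
  have := key (-v)
  simp only [map_neg, integral_neg] at this
  linarith

end LatentModel

/-! ### Sums over an i.i.d. sample -/

section Sample

variable {Ω O : Type*} [MeasurableSpace Ω] [MeasurableSpace O] {P : Measure Ω}
  {P₀ : Measure O} {ξ : ℕ → Ω → O}

theorem ae_forall_of_ae_law (hmeas : ∀ i, Measurable (ξ i)) (hlaw : ∀ i, P.map (ξ i) = P₀)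
    {p : O → Prop} (hp : ∀ᵐ o ∂P₀, p o) : ∀ᵐ ω ∂P, ∀ i, p (ξ i ω) := by
  rw [ae_all_iff]
  intro i
  rw [← hlaw i] at hp
  exact ae_of_ae_map (hmeas i).aemeasurable hp

theorem integrable_comp_law (hmeas : ∀ i, Measurable (ξ i)) (hlaw : ∀ i, P.map (ξ i) = P₀)
    {φ : O → ℝ} (hφ : Integrable φ P₀) (i : ℕ) : Integrable (fun ω => φ (ξ i ω)) P := by
  rw [← hlaw i] at hφ
  exact hφ.comp_measurable (hmeas i)

theorem integral_comp_law (hmeas : ∀ i, Measurable (ξ i)) (hlaw : ∀ i, P.map (ξ i) = P₀)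
    {φ : O → ℝ} (hφ : Integrable φ P₀) (i : ℕ) : ∫ ω, φ (ξ i ω) ∂P = ∫ o, φ o ∂P₀ := by
  rw [← hlaw i] at hφ ⊢
  exact (integral_map (hmeas i).aemeasurable hφ.aestronglyMeasurable).symm

theorem iIndepFun_comp_law (hmeas : ∀ i, Measurable (ξ i)) (hindep : iIndepFun ξ P)
    (hlaw : ∀ i, P.map (ξ i) = P₀) {φ : O → ℝ} (hφ : AEMeasurable φ P₀) :
    iIndepFun (fun i ω => φ (ξ i ω)) P :=
  hindep.comp₀ (fun _ => φ) (fun i => (hmeas i).aemeasurable) fun i => by rwa [hlaw i]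

theorem identDistrib_comp_law (hmeas : ∀ i, Measurable (ξ i))
    (hlaw : ∀ i, P.map (ξ i) = P₀) {φ : O → ℝ} (hφ : AEMeasurable φ P₀) (i j : ℕ) :
    IdentDistrib (fun ω => φ (ξ i ω)) (fun ω => φ (ξ j ω)) P P := by
  have h : IdentDistrib (ξ i) (ξ j) P P :=
    ⟨(hmeas i).aemeasurable, (hmeas j).aemeasurable, by rw [hlaw i, hlaw j]⟩
  exact h.comp_of_aemeasurable (by rwa [hlaw i])

theorem tendstoInMeasure_sampleMean [IsProbabilityMeasure P] (hmeas : ∀ i, Measurable (ξ i))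
    (hindep : iIndepFun ξ P) (hlaw : ∀ i, P.map (ξ i) = P₀) {φ : O → ℝ} (hφ : Integrable φ P₀) :
    TendstoInMeasure P (fun (n : ℕ) ω => (∑ i, φ (sample ξ n ω i)) / n) atTop
      fun _ => ∫ o, φ o ∂P₀ := by
  have hsum : ∀ (n : ℕ) ω, ∑ i, φ (sample ξ n ω i) = ∑ i ∈ Finset.range n, φ (ξ i ω) :=
    fun n ω => Fin.sum_univ_eq_sum_range (fun i => φ (ξ i ω)) n
  simp only [hsum]
  have hi := integrable_comp_law hmeas hlaw hφ
  refine tendstoInMeasure_of_tendsto_ae (fun n => ?_) ?_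
  · exact ((integrable_finsetSum _ fun i _ => hi i).div_const _).aestronglyMeasurable
  · rw [← integral_comp_law hmeas hlaw hφ 0]
    exact strong_law_ae_real (fun i ω => φ (ξ i ω)) (hi 0)
      (fun i j hij => (iIndepFun_comp_law hmeas hindep hlaw
        hφ.aestronglyMeasurable.aemeasurable).indepFun hij)
      fun i => identDistrib_comp_law hmeas hlaw hφ.aestronglyMeasurable.aemeasurable i 0

theorem boundedInProb_normalized_sum [IsProbabilityMeasure P] [IsFiniteMeasure P₀]
    (hmeas : ∀ i, Measurable (ξ i)) (hindep : iIndepFun ξ P) (hlaw : ∀ i, P.map (ξ i) = P₀)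
    {φ : O → ℝ} (hφ : MemLp φ 2 P₀) (hmean : ∫ o, φ o ∂P₀ = 0) :
    BoundedInProb P fun (n : ℕ) ω => (Real.sqrt n)⁻¹ * ∑ i, φ (sample ξ n ω i) := by
  have hφi : Integrable φ P₀ := hφ.integrable one_le_two
  have hae := hφi.aestronglyMeasurable.aemeasurable
  have hL : ∀ i, MemLp (fun ω => φ (ξ i ω)) 2 P := fun i => by
    rw [← hlaw i] at hφ
    exact hφ.comp_of_map (hmeas i).aemeasurable
  have hsum : ∀ (n : ℕ), (fun ω => (Real.sqrt n)⁻¹ * ∑ i, φ (sample ξ n ω i)) =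
      fun ω => (Real.sqrt n)⁻¹ * (∑ i ∈ Finset.range n, fun ω => φ (ξ i ω)) ω := fun n => by
    funext ω
    rw [Finset.sum_apply, ← Fin.sum_univ_eq_sum_range (fun i => φ (ξ i ω)) n]
    rfl
  refine .of_variance_le (σ := Var[fun ω => φ (ξ 0 ω); P]) (fun n => ?_) (fun n => ?_) fun n => ?_
  · rw [hsum]
    exact (memLp_finsetSum' _ fun i _ => hL i).const_mul _
  · rw [hsum, integral_const_mul]
    simp only [Finset.sum_apply]
    rw [integral_finsetSum _ fun i _ => (hL i).integrable one_le_two]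
    simp [integral_comp_law hmeas hlaw hφi, hmean]
  · have hv : ∀ i, Var[fun ω => φ (ξ i ω); P] = Var[fun ω => φ (ξ 0 ω); P] := fun i =>
      (identDistrib_comp_law hmeas hlaw hae i 0).variance_eq
    rw [hsum, variance_const_mul, IndepFun.variance_sum (fun i _ => hL i)
      (fun i _ j _ hij => (iIndepFun_comp_law hmeas hindep hlaw hae).indepFun hij)]
    simp only [hv, Finset.sum_const, Finset.card_range, nsmul_eq_mul]
    rw [inv_pow, Real.sq_sqrt n.cast_nonneg, ← mul_assoc]
    exact mul_le_of_le_one_left (variance_nonneg _ _) (inv_mul_le_one_of_le₀ le_rfl n.cast_nonneg)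

end Sample

/-! ### The log-likelihood at a root-n consistent estimator -/

/-- A root-`n` consistent estimator is consistent. -/
theorem BoundedInProb.withHighProb_mem_ball {Ω : Type*} [MeasurableSpace Ω] {P : Measure Ω}
    {d : ℕ} {t : ℕ → Ω → Par d} {θs : Par d}
    (ht : BoundedInProb P fun n ω => Real.sqrt n * ‖t n ω - θs‖) {r : ℝ} (hr : 0 < r) :
    WithHighProb P fun n ω => t n ω ∈ Metric.ball θs r := by
  have hlim : Tendsto (fun n : ℕ => Real.sqrt n * r) atTop atTop :=
    (Real.tendsto_sqrt_atTop.comp tendsto_natCast_atTop_atTop).atTop_mul_const hr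
  refine (ht.lt_of_tendsto_atTop hlim).mono ?_
  filter_upwards [eventually_gt_atTop 0] with n hn ω hω
  have hs : 0 < Real.sqrt n := Real.sqrt_pos.2 (by exact_mod_cast hn)
  rw [abs_of_nonneg (by positivity)] at hω
  rw [Metric.mem_ball, dist_eq_norm]
  exact lt_of_mul_lt_mul_left hω hs.le

namespace LatentModel

variable {X Y : Type*} [MeasurableSpace X] [MeasurableSpace Y] {ν : Measure Y}

theorem sampleLik_pos (M : LatentModel X Y ν) {n : ℕ} {D : Fin n → X × Y} {θ : Par M.d}
    (h : ∀ i, 0 < M.lik (D i) θ) : 0 < M.sampleLik D θ :=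
  Finset.prod_pos fun i _ => h i

theorem log_sampleLik (M : LatentModel X Y ν) {n : ℕ} {D : Fin n → X × Y} {θ : Par M.d}
    (h : ∀ i, 0 < M.lik (D i) θ) :
    Real.log (M.sampleLik D θ) = ∑ i, M.logLik (D i) θ :=
  Real.log_prod fun i _ => (h i).ne'

/-- The first-order Taylor bound for one observation, summed over the sample. -/
theorem abs_sum_logLik_sub_le (M : LatentModel X Y ν) {n : ℕ} {D : Fin n → X × Y}
    {θ θs : Par M.d} {H : X × Y → ℝ}
    (h : ∀ i, |M.logLik (D i) θ - M.logLik (D i) θs -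
      fderiv ℝ (M.logLik (D i)) θs (θ - θs)| ≤ H (D i) * ‖θ - θs‖ ^ 2) :
    |∑ i, M.logLik (D i) θ - ∑ i, M.logLik (D i) θs| ≤
      ‖θ - θs‖ * ∑ j, |∑ i, fderiv ℝ (M.logLik (D i)) θs (EuclideanSpace.single j 1)| +
        (∑ i, H (D i)) * ‖θ - θs‖ ^ 2 := by
  set δ := θ - θs with hδ
  have hdec : δ = ∑ j, δ j • (EuclideanSpace.single j 1 : Par M.d) := by
    have := (EuclideanSpace.basisFun (Fin M.d) ℝ).sum_repr δ
    simpa using this.symm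
  have hlin : ∑ i, fderiv ℝ (M.logLik (D i)) θs δ =
      ∑ j, δ j * ∑ i, fderiv ℝ (M.logLik (D i)) θs (EuclideanSpace.single j 1) := by
    have h1 : ∀ i, fderiv ℝ (M.logLik (D i)) θs δ =
        ∑ j, δ j * fderiv ℝ (M.logLik (D i)) θs (EuclideanSpace.single j 1) := fun i => by
      conv_lhs => rw [hdec]
      simp only [map_sum, map_smul, smul_eq_mul]
    simp only [h1, Finset.mul_sum]
    exact Finset.sum_comm
  have hsplit : ∑ i, M.logLik (D i) θ - ∑ i, M.logLik (D i) θs =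
      ∑ i, fderiv ℝ (M.logLik (D i)) θs δ +
        ∑ i, (M.logLik (D i) θ - M.logLik (D i) θs - fderiv ℝ (M.logLik (D i)) θs δ) := by
    simp only [Finset.sum_sub_distrib]
    ring
  rw [hsplit]
  refine (_root_.abs_add_le _ _).trans (add_le_add ?_ ?_)
  · rw [hlin, Finset.mul_sum]
    refine (Finset.abs_sum_le_sum_abs _ _).trans (Finset.sum_le_sum fun j _ => ?_)
    rw [abs_mul]
    gcongr
    simpa using PiLp.norm_apply_le δ j
  · rw [Finset.sum_mul]
    exact (Finset.abs_sum_le_sum_abs _ _).trans (Finset.sum_le_sum fun i _ => h i)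

/-- Replacing the true value by a root-`n` consistent estimator changes the log-likelihood of the
sample by `O_P(1)`: the centred score sum is `O_P(√n)` and the second-order term is
`O_P(n) · O_P(1/n)`. -/
theorem Regular.boundedInProb_logLik_sub {M : LatentModel X Y ν} {P₀ : Measure (X × Y)}
    [IsProbabilityMeasure P₀] {θs : Par M.d} (h : M.Regular P₀ θs) (hv : M.IsTrueValue P₀ θs)
    {Ω : Type*} [MeasurableSpace Ω] {P : Measure Ω} [IsProbabilityMeasure P]
    {ξ : ℕ → Ω → X × Y} (hmeas : ∀ i, Measurable (ξ i)) (hindep : iIndepFun ξ P)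
    (hlaw : ∀ i, P.map (ξ i) = P₀) {t : ℕ → Ω → Par M.d}
    (ht : BoundedInProb P fun n ω => Real.sqrt n * ‖t n ω - θs‖) :
    BoundedInProb P fun n ω => ∑ i, M.logLik (sample ξ n ω i) (t n ω) -
      ∑ i, M.logLik (sample ξ n ω i) θs := by
  obtain ⟨r, hr, -, H, hH, hTaylor⟩ := h.exists_taylor
  have hscore : BoundedInProb P fun n ω => ∑ j, |(Real.sqrt n)⁻¹ *
      ∑ i, fderiv ℝ (M.logLik (sample ξ n ω i)) θs (EuclideanSpace.single j 1)| :=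
    .finsetSum _ fun j _ => (boundedInProb_normalized_sum hmeas hindep hlaw (h.score_memLp _)
      (h.integral_score_eq_zero hv (EuclideanSpace.single j 1))).of_le
        (.of_ae <| ae_of_all _ fun _ _ => (abs_abs _).le)
  have hrem := BoundedInProb.of_tendstoInMeasure
    (tendstoInMeasure_sampleMean hmeas hindep hlaw hH)
  refine ((ht.mul hscore).add (hrem.mul (ht.mul ht))).of_le
    (((ht.withHighProb_mem_ball hr).and
      (.of_ae (A := fun _ ω => ∀ i, _) ((ae_forall_of_ae_law hmeas hlaw hTaylor).mono
        fun ω hω _ => hω))).mono ?_)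
  filter_upwards [eventually_gt_atTop 0] with n hn ω hω
  have hn' : (0 : ℝ) < n := by exact_mod_cast hn
  have hs : 0 < Real.sqrt n := Real.sqrt_pos.2 hn'
  refine (M.abs_sum_logLik_sub_le (D := sample ξ n ω) (H := H) fun i => hω.2 i _ hω.1).trans
    (le_trans (le_of_eq ?_) (le_abs_self _))
  simp only [abs_mul, ← Finset.mul_sum, abs_of_pos (inv_pos.2 hs)]
  congr 1
  · field_simp
  · rw [show Real.sqrt n * ‖t n ω - θs‖ * (Real.sqrt n * ‖t n ω - θs‖) =
      (Real.sqrt n) ^ 2 * ‖t n ω - θs‖ ^ 2 by ring, Real.sq_sqrt hn'.le]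
    field_simp

end LatentModel

/-! ### Location of the variational mean -/

/-- If a probability density puts at least half of its mass on the ball of radius `ρ` around `a`,
and `b` is further than `2ρ` from `a`, then its second moment around `b` is at least `ρ² / 2`. -/
theorem half_sq_le_integral_of_mass {d : ℕ} {q : Par d → ℝ} (hq0 : ∀ v, 0 ≤ q v)
    (hqi : Integrable q) (hq1 : ∫ v, q v = 1) {a b : Par d} {ρ : ℝ} (hρ : 0 ≤ ρ)
    (hmom : Integrable fun v => q v * ‖v - b‖ ^ 2)
    (hmass : ∫ v in {v | ρ < ‖v - a‖}, q v ≤ 1 / 2) (hab : 2 * ρ < ‖b - a‖) :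
    ρ ^ 2 / 2 ≤ ∫ v, q v * ‖v - b‖ ^ 2 := by
  have hB : MeasurableSet {v : Par d | ρ < ‖v - a‖} :=
    measurableSet_lt measurable_const (by fun_prop)
  have hcompl : 1 / 2 ≤ ∫ v in {v | ρ < ‖v - a‖}ᶜ, q v := by
    have := integral_add_compl hB hqi
    rw [hq1] at this
    linarith
  calc ρ ^ 2 / 2 ≤ ∫ v in {v | ρ < ‖v - a‖}ᶜ, q v * ρ ^ 2 := by
        rw [integral_mul_const]
        nlinarith [sq_nonneg ρ]
    _ ≤ ∫ v in {v | ρ < ‖v - a‖}ᶜ, q v * ‖v - b‖ ^ 2 := by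
        refine setIntegral_mono_on (hqi.mul_const _).integrableOn hmom.integrableOn hB.compl ?_
        intro v hv
        have hv : ‖v - a‖ ≤ ρ := not_lt.1 hv
        have h1 : ‖b - a‖ ≤ ‖v - a‖ + ‖v - b‖ := by
          calc ‖b - a‖ = ‖(v - a) - (v - b)‖ := by congr 1; abel
            _ ≤ _ := norm_sub_le _ _
        have h2 : ρ ≤ ‖v - b‖ := by linarith
        have := hq0 v
        gcongr
    _ ≤ ∫ v, q v * ‖v - b‖ ^ 2 :=
        setIntegral_le_integral hmom (ae_of_all _ fun v => mul_nonneg (hq0 v) (sq_nonneg _))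

theorem integrable_mul_norm_sub_sq {d : ℕ} {q : Par d → ℝ} (hq0 : ∀ v, 0 ≤ q v)
    (hqi : Integrable q) (hmom : Integrable fun v => q v * ‖v‖ ^ 2) (b : Par d) :
    Integrable fun v => q v * ‖v - b‖ ^ 2 := by
  refine Integrable.mono' ((hmom.const_mul 2).add (hqi.const_mul (2 * ‖b‖ ^ 2)))
    (hqi.aestronglyMeasurable.mul (by fun_prop)) (ae_of_all _ fun v => ?_)
  rw [Real.norm_of_nonneg (mul_nonneg (hq0 v) (sq_nonneg _))]
  have h1 : ‖v - b‖ ≤ ‖v‖ + ‖b‖ := norm_sub_le _ _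
  have h2 : ‖v - b‖ ^ 2 ≤ 2 * ‖v‖ ^ 2 + 2 * ‖b‖ ^ 2 := by
    nlinarith [norm_nonneg (v - b), sq_nonneg (‖v‖ - ‖b‖)]
  simp only [Pi.add_apply]
  nlinarith [hq0 v]

namespace MeanField

variable {X Y : Type*} [MeasurableSpace X] [MeasurableSpace Y] {ν : Measure Y}
  {M : LatentModel X Y ν} {Ω : Type*} [MeasurableSpace Ω] {P : Measure Ω} {ξ : ℕ → Ω → X × Y}

theorem sum_cov_diag (Q : MeanField M) {n : ℕ} {D : Fin n → X × Y}
    (hq : IsDensityWithMean (Q.qθ n D)) (hmom : Integrable fun θ => Q.qθ n D θ * ‖θ‖ ^ 2) :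
    ∑ i, Q.cov D i i = ∫ θ, Q.qθ n D θ * ‖θ - Q.θHat D‖ ^ 2 := by
  have hint := integrable_mul_norm_sub_sq hq.1 hq.2.1 hmom (Q.θHat D)
  unfold cov
  rw [← integral_finsetSum]
  · refine integral_congr_ae (ae_of_all _ fun θ => ?_)
    simp only
    rw [← Finset.mul_sum, EuclideanSpace.norm_sq_eq]
    congr 1
    refine Finset.sum_congr rfl fun i _ => ?_
    rw [Real.norm_eq_abs, sq_abs, PiLp.sub_apply, sq]
  · intro i _
    refine Integrable.mono' hint (hq.2.1.aestronglyMeasurable.mul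
      (by fun_prop : Continuous fun θ : Par M.d =>
        (θ i - Q.θHat D i) * (θ i - Q.θHat D i)).aestronglyMeasurable) (ae_of_all _ fun θ => ?_)
    rw [← sq, Real.norm_of_nonneg (mul_nonneg (hq.1 θ) (sq_nonneg _))]
    have h1 : |θ i - Q.θHat D i| ≤ ‖θ - Q.θHat D‖ := by
      simpa using PiLp.norm_apply_le (θ - Q.θHat D) i
    have := hq.1 θ
    rw [← sq_abs (θ i - Q.θHat D i)]
    gcongr

/-- The variational mean is root-`n` consistent. The factor `q(θ)` keeps most of its mass within
`a n / √n` of the true value for every `a n → ∞`; if its mean were much further away, its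
covariance would exceed the order `1/n`. -/
theorem boundedInProb_θHat (Q : MeanField M) {θs : Par M.d}
    {S : Matrix (Fin M.d) (Fin M.d) ℝ} (hq : Q.WellDefined P ξ) (hc : Q.Contracts P ξ θs)
    (hV : Q.CovScales P ξ S) :
    BoundedInProb P fun n ω => Real.sqrt n * ‖Q.θHat (sample ξ n ω) - θs‖ := by
  refine .of_forall_tendsto_atTop fun a ha => ?_
  have hR : Tendsto (fun n => a n / 2) atTop atTop := ha.atTop_div_const two_pos
  have hmass := WithHighProb.of_tendstoInMeasure (hc _ hR) (δ := 1 / 2) (by norm_num)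
  have htrace : WithHighProb P fun n ω => ∀ i,
      |(n : ℝ) * Q.cov (sample ξ n ω) i i - S i i| < 1 :=
    .forall_finite fun i => .of_tendstoInMeasure (hV i i) one_pos
  refine ((hq.and hmass).and htrace).mono ?_
  have hbig : ∀ᶠ n in atTop, 2 * (∑ i, (S i i + 1)) + 1 < a n / 2 := hR.eventually_gt_atTop _
  filter_upwards [eventually_gt_atTop 0, hbig, hR.eventually_gt_atTop 1]
    with n hn hbig h1 ω hω
  obtain ⟨⟨⟨-, hqd, hmom⟩, hm⟩, ht⟩ := hω
  have hn' : (0 : ℝ) < n := by exact_mod_cast hn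
  have hs : 0 < Real.sqrt n := Real.sqrt_pos.2 hn'
  rw [abs_of_nonneg (by positivity)]
  by_contra hcon
  push Not at hcon
  set ρ := a n / 2 / Real.sqrt n with hρ
  have hset : {θ : Par M.d | a n / 2 < Real.sqrt n * ‖θ - θs‖} = {θ | ρ < ‖θ - θs‖} := by
    ext θ
    simp only [Set.mem_ofPred_eq, hρ, div_lt_iff₀ hs]
    rw [mul_comm]
  rw [hset, sub_zero] at hm
  have hlow := half_sq_le_integral_of_mass hqd.1 hqd.2.1 hqd.2.2.1 (a := θs)
    (b := Q.θHat (sample ξ n ω)) (ρ := ρ) (by positivity)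
    (integrable_mul_norm_sub_sq hqd.1 hqd.2.1 hmom _) ((le_abs_self _).trans hm.le)
    (by rw [hρ, ← mul_div_assoc, mul_div_cancel₀ _ two_ne_zero, div_lt_iff₀ hs]; linarith)
  rw [← Q.sum_cov_diag hqd hmom] at hlow
  have hup : (n : ℝ) * ∑ i, Q.cov (sample ξ n ω) i i ≤ ∑ i, (S i i + 1) := by
    rw [Finset.mul_sum]
    refine Finset.sum_le_sum fun i _ => ?_
    linarith [(abs_lt.1 (ht i)).2]
  have hρ2 : (n : ℝ) * (ρ ^ 2 / 2) = (a n / 2) ^ 2 / 2 := by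
    rw [hρ, div_pow, Real.sq_sqrt hn'.le]
    field_simp
  have := mul_le_mul_of_nonneg_left hlow hn'.le
  rw [hρ2] at this
  nlinarith

/-! ### The variational density at its mean -/

theorem _root_.continuous_gaussDensity {d : ℕ} (S : Matrix (Fin d) (Fin d) ℝ) :
    Continuous (gaussDensity S) := by
  unfold gaussDensity
  have h : Continuous fun h : Par d => h.ofLp ⬝ᵥ (S⁻¹.mulVec h.ofLp) := by
    have h1 : Continuous fun h : Par d => h.ofLp := PiLp.continuous_ofLp 2 _
    exact h1.dotProduct (continuous_const.matrix_mulVec h1)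
  exact continuous_const.mul (Real.continuous_exp.comp (continuous_const.mul h))

theorem _root_.gaussDensity_pos {d : ℕ} {S : Matrix (Fin d) (Fin d) ℝ} (hS : S.PosDef) (h : Par d) :
    0 < gaussDensity S h := by
  have hdet := hS.det_pos
  unfold gaussDensity
  positivity

/-- On the scale of its standard deviation the Gaussian density is bounded away from `0` and `∞`,
and `√n (θ̂ - m)` is `O_P(1)`; hence `q(θ̂)` is of exact order `n^{d/2}`. -/
theorem log_qθ_θHat (Q : MeanField M) {θs : Par M.d} {S : Matrix (Fin M.d) (Fin M.d) ℝ}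
    (hS : S.PosDef) (hg : Q.AsympGaussian P ξ θs S)
    (hθ : BoundedInProb P fun n ω => Real.sqrt n * ‖Q.θHat (sample ξ n ω) - θs‖) :
    WithHighProb P (fun n ω => 0 < Q.qθ n (sample ξ n ω) (Q.θHat (sample ξ n ω))) ∧
      BoundedInProb P fun n ω => Real.log (Q.qθ n (sample ξ n ω) (Q.θHat (sample ξ n ω))) -
        M.d / 2 * Real.log n := by
  obtain ⟨m, hm, hconv⟩ := hg
  have hloc := hθ.abs_add_abs hm
  have key : ∀ R : ℝ, 0 < R → ∃ c > 0, ∃ C : ℝ, WithHighProb P fun n ω =>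
      |(|Real.sqrt n * ‖Q.θHat (sample ξ n ω) - θs‖| +
        |Real.sqrt n * ‖m n (sample ξ n ω) - θs‖|)| ≤ R →
      c ≤ (Real.sqrt n ^ M.d)⁻¹ * Q.qθ n (sample ξ n ω) (Q.θHat (sample ξ n ω)) ∧
      (Real.sqrt n ^ M.d)⁻¹ * Q.qθ n (sample ξ n ω) (Q.θHat (sample ξ n ω)) ≤ C := by
    intro R hR
    have hcpt : IsCompact (Metric.closedBall (0 : Par M.d) R) := isCompact_closedBall _ _
    have hne : (Metric.closedBall (0 : Par M.d) R).Nonempty :=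
      ⟨0, Metric.mem_closedBall_self hR.le⟩
    obtain ⟨x, -, hx⟩ := hcpt.exists_isMinOn hne (continuous_gaussDensity S).continuousOn
    obtain ⟨y, -, hy⟩ := hcpt.exists_isMaxOn hne (continuous_gaussDensity S).continuousOn
    have hc := gaussDensity_pos hS x
    refine ⟨gaussDensity S x / 2, half_pos hc, gaussDensity S y + gaussDensity S x / 2, ?_⟩
    refine (hconv R hR _ (half_pos hc)).mono ?_
    filter_upwards [eventually_gt_atTop 0] with n hn ω hω hle
    have hs : 0 < Real.sqrt n := Real.sqrt_pos.2 (by exact_mod_cast hn)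
    set h : Par M.d := Real.sqrt n • (Q.θHat (sample ξ n ω) - m n (sample ξ n ω)) with hh
    have hnorm : ‖h‖ ≤ R := by
      rw [hh, norm_smul, Real.norm_of_nonneg hs.le]
      have hle' := (le_abs_self _).trans hle
      rw [abs_of_nonneg (by positivity), abs_of_nonneg (by positivity), ← mul_add] at hle'
      refine le_trans ?_ hle'
      gcongr
      exact (norm_sub_le_norm_sub_add_norm_sub _ θs _).trans
        (by rw [norm_sub_rev θs])
    have heq : m n (sample ξ n ω) + (Real.sqrt n)⁻¹ • h = Q.θHat (sample ξ n ω) := by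
      rw [hh, smul_smul, inv_mul_cancel₀ hs.ne', one_smul, add_sub_cancel]
    have habs := hω h hnorm
    rw [heq] at habs
    have hmem : h ∈ Metric.closedBall (0 : Par M.d) R := by
      rwa [mem_closedBall_zero_iff]
    have h1 : gaussDensity S x ≤ gaussDensity S h := hx hmem
    have h2 : gaussDensity S h ≤ gaussDensity S y := hy hmem
    rw [abs_lt] at habs
    constructor <;> linarith [habs.1, habs.2]
  have hpos : ∀ {n : ℕ} {v : ℝ}, 0 < n → 0 < (Real.sqrt n ^ M.d)⁻¹ * v → 0 < v := by
    intro n v hn hv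
    have hs : 0 < Real.sqrt n := Real.sqrt_pos.2 (by exact_mod_cast hn)
    exact (pos_iff_pos_of_mul_pos hv).1 (by positivity)
  constructor
  · refine hloc.withHighProb_of_local fun R hR => ?_
    obtain ⟨c, hc, C, hw⟩ := key R hR
    refine hw.mono ?_
    filter_upwards [eventually_gt_atTop 0] with n hn ω hω hle
    exact hpos hn (hc.trans_le (hω hle).1)
  · refine hloc.of_local fun R hR => ?_
    obtain ⟨c, hc, C, hw⟩ := key R hR
    refine ⟨max |Real.log c| |Real.log C|, hw.mono ?_⟩
    filter_upwards [eventually_gt_atTop 0] with n hn ω hω hle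
    obtain ⟨h1, h2⟩ := hω hle
    have hs : 0 < Real.sqrt n := Real.sqrt_pos.2 (by exact_mod_cast hn)
    have hv := hc.trans_le h1
    have hq := hpos hn hv
    have hlog : Real.log (Q.qθ n (sample ξ n ω) (Q.θHat (sample ξ n ω))) -
        M.d / 2 * Real.log n = Real.log ((Real.sqrt n ^ M.d)⁻¹ *
          Q.qθ n (sample ξ n ω) (Q.θHat (sample ξ n ω))) := by
      rw [Real.log_mul (by positivity) hq.ne', Real.log_inv, Real.log_pow,
        Real.log_sqrt n.cast_nonneg]
      ring
    rw [hlog]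
    exact abs_le_max_abs_abs (Real.log_le_log hc h1) (Real.log_le_log hv h2)

/-! ### Expansion of the criterion -/

theorem log_latentRatio (Q : MeanField M) (hr : Q.RatioCondition P ξ)
    (hL : WithHighProb P fun n ω => 0 < M.sampleLik (sample ξ n ω) (Q.θHat (sample ξ n ω))) :
    WithHighProb P (fun n ω => 0 < Q.latentRatio (sample ξ n ω)) ∧
      BoundedInProb P fun n ω => Real.log (Q.latentRatio (sample ξ n ω)) -
        Real.log (M.sampleLik (sample ξ n ω) (Q.θHat (sample ξ n ω))) := by
  have key : ∀ ε : ℝ, 0 < ε → ∃ C : ℝ, ∀ᶠ n in atTop,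
      P {ω | ¬ (0 < Q.latentRatio (sample ξ n ω) ∧
        |Real.log (Q.latentRatio (sample ξ n ω)) -
          Real.log (M.sampleLik (sample ξ n ω) (Q.θHat (sample ξ n ω)))| ≤ C)} ≤
        ENNReal.ofReal ε := by
    intro ε hε
    obtain ⟨C, hC, hev⟩ := hr (ε / 2) (half_pos hε)
    refine ⟨|Real.log C|, ?_⟩
    filter_upwards [hev, withHighProb_iff.1 hL (ε / 2) (half_pos hε)] with n h1 h2
    rw [← add_halves ε, ENNReal.ofReal_add (half_pos hε).le (half_pos hε).le]
    refine le_trans (measure_mono ?_) ((measure_union_le _ _).trans (add_le_add h1 h2))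
    intro ω hω
    by_contra hcon
    simp only [Set.mem_union, Set.mem_ofPred_eq, not_or, not_not] at hcon
    obtain ⟨⟨hlo, hup⟩, hLpos⟩ := hcon
    have hpos := (mul_pos (inv_pos.2 hC) hLpos).trans_le hlo
    refine hω ⟨hpos, ?_⟩
    have l1 := Real.log_le_log (mul_pos (inv_pos.2 hC) hLpos) hlo
    have l2 := Real.log_le_log hpos hup
    rw [Real.log_mul (inv_pos.2 hC).ne' hLpos.ne', Real.log_inv] at l1
    rw [Real.log_mul hC.ne' hLpos.ne'] at l2
    rw [abs_le]
    constructor <;> linarith [le_abs_self (Real.log C)]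
  constructor
  · rw [withHighProb_iff]
    intro ε hε
    obtain ⟨C, hev⟩ := key ε hε
    filter_upwards [hev] with n hn
    refine (measure_mono fun ω hω => ?_).trans hn
    rw [Set.mem_ofPred_eq] at hω ⊢
    exact fun hcon => hω hcon.1
  · intro ε hε
    obtain ⟨C, hev⟩ := key ε hε
    refine ⟨C, ?_⟩
    filter_upwards [hev] with n hn
    refine (measure_mono fun ω hω => ?_).trans hn
    rw [Set.mem_ofPred_eq] at hω ⊢
    exact fun hcon => not_le.2 hω hcon.2

/-- The expansion that the criterion shares with the Bayesian information criterion: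
`log p_VBC(𝐲) = log p(𝐲 ∣ θs) - (d / 2) log n + O_P(1)`. -/
theorem log_pVBC_expansion (Q : MeanField M) [IsProbabilityMeasure P] {P₀ : Measure (X × Y)}
    [IsProbabilityMeasure P₀] {θs : Par M.d} {S : Matrix (Fin M.d) (Fin M.d) ℝ}
    (hmeas : ∀ i, Measurable (ξ i)) (hindep : iIndepFun ξ P) (hlaw : ∀ i, P.map (ξ i) = P₀)
    (hvalue : M.IsTrueValue P₀ θs) (hreg : M.Regular P₀ θs) (hprior : M.PriorRegular P ξ θs)
    (hq : Q.WellDefined P ξ) (hS : S.PosDef) (hgauss : Q.AsympGaussian P ξ θs S)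
    (hcontract : Q.Contracts P ξ θs) (hcov : Q.CovScales P ξ S) (hratio : Q.RatioCondition P ξ) :
    BoundedInProb P fun n ω => Real.log (Q.pVBC (sample ξ n ω)) -
      ∑ i, M.logLik (sample ξ n ω i) θs + M.d / 2 * Real.log n := by
  have hθ := Q.boundedInProb_θHat hq hcontract hcov
  have hlik := hreg.boundedInProb_logLik_sub hvalue hmeas hindep hlaw hθ
  obtain ⟨r₀, hr₀, hsub, -⟩ := hreg.exists_taylor
  have hlikpos : WithHighProb P fun n ω =>
      ∀ i, 0 < M.lik (sample ξ n ω i) (Q.θHat (sample ξ n ω)) :=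
    ((hθ.withHighProb_mem_ball hr₀).and
      (.of_ae (A := fun _ ω => ∀ i, ∀ θ ∈ M.Θ, 0 < M.lik (ξ i ω) θ)
        ((ae_forall_of_ae_law hmeas hlaw hreg.pos).mono fun ω hω _ => hω))).mono
      (Eventually.of_forall fun n ω hω i => hω.2 i _ (hsub hω.1))
  obtain ⟨hrpos, hrb⟩ := Q.log_latentRatio hratio
    (hlikpos.mono (Eventually.of_forall fun n ω hω => M.sampleLik_pos hω))
  obtain ⟨hqpos, hqb⟩ := Q.log_qθ_θHat hS hgauss hθ
  obtain ⟨r, hr, c, hc, C, hpr⟩ := hprior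
  have hprw : WithHighProb P fun n ω =>
      c ≤ M.prior n (fun i => (sample ξ n ω i).1) (Q.θHat (sample ξ n ω)) ∧
        M.prior n (fun i => (sample ξ n ω i).1) (Q.θHat (sample ξ n ω)) ≤ C :=
    (hpr.and (hθ.withHighProb_mem_ball hr)).mono
      (Eventually.of_forall fun n ω hω => hω.1 _ hω.2)
  have hprb : BoundedInProb P fun n ω =>
      Real.log (M.prior n (fun i => (sample ξ n ω i).1) (Q.θHat (sample ξ n ω))) :=
    .of_withHighProb (max |Real.log c| |Real.log C|) (hprw.mono (Eventually.of_forall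
      fun n ω hω => abs_le_max_abs_abs (Real.log_le_log hc hω.1)
        (Real.log_le_log (hc.trans_le hω.1) hω.2)))
  refine (((hrb.add hlik).add hprb).sub hqb).of_le
    ((((hlikpos.and hrpos).and hqpos).and hprw).mono
      (Eventually.of_forall fun n ω hω => le_of_eq ?_))
  obtain ⟨⟨⟨h1, h2⟩, h3⟩, h4, -⟩ := hω
  have h4 := hc.trans_le h4
  have hp : Q.pVBC (sample ξ n ω) = Q.latentRatio (sample ξ n ω) *
      (M.prior n (fun i => (sample ξ n ω i).1) (Q.θHat (sample ξ n ω)) /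
        Q.qθ n (sample ξ n ω) (Q.θHat (sample ξ n ω))) := mul_div_mul_comm _ _ _ _
  rw [hp, Real.log_mul h2.ne' (div_pos h4 h3).ne', Real.log_div h4.ne' h3.ne',
    M.log_sampleLik h1]
  congr 1
  ring

end MeanField

/-! ### Consistency of the selection rule -/

namespace LatentModel

variable {X Y : Type*} [MeasurableSpace X] [MeasurableSpace Y] {ν : Measure Y}

/-- Under a law `p` in the model `M`, the value of a rival model that maximizes its expected
log-likelihood either has the log-likelihood of `p`, if the rival contains `p`, or a strictly
smaller expected log-likelihood. -/
theorem logLik_ae_eq_or_integral_lt {M M' : LatentModel X Y ν} [SigmaFinite ν]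
    {μX : Measure X} [IsProbabilityMeasure μX] {θ : Par M.d} {θ' : Par M'.d} (hθ : θ ∈ M.Θ)
    (hvalue' : M'.IsTrueValue (M.law μX θ) θ')
    (hreg : M.Regular (M.law μX θ) θ) (hreg' : M'.Regular (M.law μX θ) θ') :
    (M'.Contains μX (fun o => M.lik o θ) ∧
      ∀ᵐ o ∂(M.law μX θ), M'.logLik o θ' = M.logLik o θ) ∨
    ∫ o, M'.logLik o θ' ∂(M.law μX θ) < ∫ o, M.logLik o θ ∂(M.law μX θ) := by
  have gibbs : ∫ o, M.logLik o θ ∂(M.law μX θ) ≤ ∫ o, M'.logLik o θ' ∂(M.law μX θ) →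
      ∀ᵐ o ∂(μX.prod ν), M'.lik o θ' = M.lik o θ :=
    lik_ae_eq_of_integral_logLik_le hθ hvalue'.1
      (hreg.pos.mono fun o ho => ho θ hθ) (hreg'.pos.mono fun o ho => ho θ' hvalue'.1)
      hreg.moment_zero hreg'.moment_zero
  rcases lt_or_ge (∫ o, M'.logLik o θ' ∂(M.law μX θ)) (∫ o, M.logLik o θ ∂(M.law μX θ)) with h | h
  · exact Or.inr h
  · exact Or.inl ⟨⟨θ', hvalue'.1, gibbs h⟩, logLik_ae_eq_of_lik_ae_eq hθ (gibbs h)⟩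

end LatentModel

/-- A criterion gap `T + (log-likelihood difference) + b log n`, with `T = O_P(1)`, is positive with
high probability when the log-likelihood difference grows linearly. -/
theorem withHighProb_pos_of_linear {Ω : Type*} [MeasurableSpace Ω] {P : Measure Ω}
    {T L : ℕ → Ω → ℝ} {b c : ℝ} (hT : BoundedInProb P T) (hc : 0 < c)
    (hL : TendstoInMeasure P (fun (n : ℕ) ω => L n ω / n) atTop fun _ => c) :
    WithHighProb P fun n ω => 0 < T n ω + L n ω + b * Real.log n := by
  have hlim : Tendsto (fun n : ℕ => c / 2 * (n : ℝ) + b * Real.log n) atTop atTop := by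
    have h1 : Tendsto (fun x : ℝ => c / 2 + b * (Real.log x / x)) atTop (𝓝 (c / 2 + b * 0)) :=
      tendsto_const_nhds.add (Tendsto.const_mul b
        (by simpa using Real.isLittleO_log_id_atTop.tendsto_div_nhds_zero))
    have h2 := (Tendsto.atTop_mul_pos (by simpa using half_pos hc) tendsto_id h1).comp
      tendsto_natCast_atTop_atTop
    refine h2.congr' ?_
    filter_upwards [eventually_gt_atTop 0] with n hn
    have : (n : ℝ) ≠ 0 := by exact_mod_cast hn.ne'
    simp only [Function.comp, id]
    field_simp
  refine ((hT.lt_of_tendsto_atTop hlim).and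
    (WithHighProb.of_tendstoInMeasure hL (half_pos hc))).mono ?_
  filter_upwards [eventually_gt_atTop 0] with n hn ω hω
  have hn' : (0 : ℝ) < n := by exact_mod_cast hn
  have h1 := (abs_lt.1 hω.1).1
  have h2 := (abs_lt.1 hω.2).1
  have h3 : c / 2 < L n ω / n := by linarith
  rw [lt_div_iff₀ hn'] at h3
  linarith

theorem argminSet_eq_singleton {ι : Type*} {f : ι → ℝ} {k : ι} (h : ∀ j, j ≠ k → f k < f j) :
    argminSet f = {k} := by
  ext j
  simp only [argminSet, Set.mem_ofPred_eq, Set.mem_singleton_iff]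
  constructor
  · intro hj
    by_contra hne
    exact (h j hne).not_ge (hj k)
  · rintro rfl i
    rcases eq_or_ne i j with rfl | hi
    · exact le_rfl
    · exact (h i hi).le

theorem WithHighProb.tendsto_one {Ω : Type*} [MeasurableSpace Ω] {P : Measure Ω}
    [IsProbabilityMeasure P] {A : ℕ → Ω → Prop} (h : WithHighProb P A) :
    Tendsto (fun n => P {ω | A n ω}) atTop (𝓝 1) := by
  have hlow : Tendsto (fun n => 1 - P {ω | ¬ A n ω}) atTop (𝓝 1) := by
    simpa using ENNReal.Tendsto.sub (tendsto_const_nhds (x := (1 : ENNReal))) h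
      (Or.inl ENNReal.one_ne_top)
  refine tendsto_of_tendsto_of_tendsto_of_le_of_le hlow tendsto_const_nhds (fun n => ?_)
    fun n => prob_le_one
  rw [tsub_le_iff_right, ← measure_univ (μ := P)]
  refine (measure_mono fun ω _ => ?_).trans (measure_union_le _ _)
  exact em (A n ω)

theorem proposition1
    {Ω X Y : Type*} [MeasurableSpace Ω] [MeasurableSpace X] [MeasurableSpace Y]
    (P : Measure Ω) [IsProbabilityMeasure P]
    (μX : Measure X) [IsProbabilityMeasure μX]
    (ν : Measure Y) [SigmaFinite ν]
    -- finitely many candidate models, their mean-field approximations, and the true model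
    (K : ℕ) (M : Fin (K + 1) → LatentModel X Y ν) (Q : ∀ k, MeanField (M k))
    (kstar : Fin (K + 1))
    -- the model-specific true parameter values and limiting covariances
    (θs : ∀ k, Par (M k).d) (S : ∀ k, Matrix (Fin (M k).d) (Fin (M k).d) ℝ)
    -- an i.i.d. sample from the model `kstar` at its true parameter value
    (ξ : ℕ → Ω → X × Y) (hmeas : ∀ i, Measurable (ξ i)) (hindep : iIndepFun ξ P)
    (hlaw : ∀ i, P.map (ξ i) = (M kstar).law μX (θs kstar))
    -- every other model that contains the data law has more parameters than `kstar`
    (htrue : ∀ k, k ≠ kstar →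
      (M k).Contains μX (fun o => (M kstar).lik o (θs kstar)) → (M kstar).d < (M k).d)
    (hvalue : ∀ k, (M k).IsTrueValue ((M kstar).law μX (θs kstar)) (θs k))
    -- (i)
    (hreg : ∀ k, (M k).Regular ((M kstar).law μX (θs kstar)) (θs k))
    (hprior : ∀ k, (M k).PriorRegular P ξ (θs k))
    (hq : ∀ k, (Q k).WellDefined P ξ)
    -- (ii), (iii)
    (hS : ∀ k, (S k).PosDef)
    (hgauss : ∀ k, (Q k).AsympGaussian P ξ (θs k) (S k))
    -- (iv)
    (hcontract : ∀ k, (Q k).Contracts P ξ (θs k))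
    (hcov : ∀ k, (Q k).CovScales P ξ (S k))
    -- (v)
    (hratio : ∀ k, (Q k).RatioCondition P ξ) :
    Tendsto (fun n => P {ω | argminSet (fun k => (Q k).VBC (sample ξ n ω)) = {kstar}})
        atTop (𝓝 1) ∧
      WithHighProb P fun n ω => argminSet (fun k => (Q k).VBC (sample ξ n ω)) = {kstar} := by
  suffices h : ∀ k, WithHighProb P fun n ω => k ≠ kstar →
      (Q kstar).VBC (sample ξ n ω) < (Q k).VBC (sample ξ n ω) by
    have hw : WithHighProb P fun n ω =>
        argminSet (fun k => (Q k).VBC (sample ξ n ω)) = {kstar} :=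
      (WithHighProb.forall_finite h).mono
        (Eventually.of_forall fun n ω hω => argminSet_eq_singleton hω)
    exact ⟨hw.tendsto_one, hw⟩
  intro k
  rcases eq_or_ne k kstar with rfl | hk
  · exact .of_ae <| ae_of_all _ fun ω n hne => absurd rfl hne
  have := (M kstar).isProbabilityMeasure_law μX (hvalue kstar).1
  have hexp := fun j => (Q j).log_pVBC_expansion hmeas hindep hlaw (hvalue j) (hreg j) (hprior j)
    (hq j) (hS j) (hgauss j) (hcontract j) (hcov j) (hratio j)
  have hT := (hexp kstar).sub (hexp k)
  rcases LatentModel.logLik_ae_eq_or_integral_lt (hvalue kstar).1 (hvalue k) (hreg kstar) (hreg k) with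
    ⟨hcont, heq⟩ | hlt
  · -- equal likelihoods: the penalty of the larger dimension decides
    have hd : (0 : ℝ) < ((M k).d - (M kstar).d) / 2 :=
      half_pos (sub_pos.2 (by exact_mod_cast htrue k hk hcont))
    have hlim : Tendsto (fun n : ℕ => (((M k).d : ℝ) - (M kstar).d) / 2 * Real.log n)
        atTop atTop :=
      (Real.tendsto_log_atTop.comp tendsto_natCast_atTop_atTop).const_mul_atTop hd
    refine ((hT.lt_of_tendsto_atTop hlim).and
      (.of_ae (A := fun _ ω => ∀ i, _) ((ae_forall_of_ae_law hmeas hlaw heq).mono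
        fun ω hω _ => hω))).mono (Eventually.of_forall fun n ω hω _ => ?_)
    have hsum : ∑ i, (M k).logLik (sample ξ n ω i) (θs k) =
        ∑ i, (M kstar).logLik (sample ξ n ω i) (θs kstar) :=
      Finset.sum_congr rfl fun i _ => hω.2 i
    have h1 := (abs_lt.1 hω.1).1
    rw [hsum] at h1
    unfold MeanField.VBC
    linarith
  · -- a positive Kullback-Leibler divergence: the log-likelihood ratio grows linearly
    have hmean := tendstoInMeasure_sampleMean hmeas hindep hlaw
      ((hreg kstar).moment_zero.sub (hreg k).moment_zero)
    rw [integral_sub' (hreg kstar).moment_zero (hreg k).moment_zero] at hmean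
    refine (withHighProb_pos_of_linear (b := (((M k).d : ℝ) - (M kstar).d) / 2) hT
      (sub_pos.2 hlt) hmean).mono (Eventually.of_forall fun n ω hω _ => ?_)
    simp only [Pi.sub_apply, Finset.sum_sub_distrib] at hω
    unfold MeanField.VBC
    linarith
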